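/- Let $(M,\omega)$ be a closed symplectic surface. An almost complex structure $J$ on $M$ is positive associated if $\omega(JX,JY)=\omega(X,Y)$ and $\omega(X,JX)>0$ for $X\ne0$; then $g(X,Y)=\omega(X,JY)$ is called an associated metric. Let $\mathcal{AM}(M)$ be the space of smooth associated metrics, with the weak Riemannian structure $(a,b)_g=\int_M \mathrm{tr}(g^{-1}a\,g^{-1}b)\,\omega$ on the tangent spaces $T_g\mathcal{AM}=\{a \text{ symmetric}: a(JX,JY)=-a(X,Y)\}$, with the operator $\mathbf J a=a(\cdot,J\cdot)$, and let $K(a,b)$ be the sectional curvature (of the Levi-Civita connection of this structure) in the plane spanned by $a,b$. Let $e_1,e_2$ be a smooth positively oriented $g$-orthonormal frame with dual coframe $e_1^*,e_2^*$, and put $dw=e_1^*+ie_2^*$. A complex function $\alpha$ defines the form $a=\alpha\,dw\otimes dw+\bar\alpha\,d\bar w\otimes d\bar w$; similarly $\beta$ defines $b$. **Torus.** Let $T^2=\mathbb R^2/2\pi\mathbb Z^2$, $\omega=dx\wedge dy$, let $g\in\mathcal{AM}(T^2)$ be arbitrary and $e_1,e_2$ a global frame as above. Consider the nonzero functions of the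 system $\cos(kx+ly)$, $\sin(kx+ly)$, $i\cos(kx+ly)$, $i\sin(kx+ly)$, $k,l\in\mathbb Z$. 1. If $\alpha,\beta$ belong to the system, are both real or both purely imaginary, and are linearly independent over $\mathbb R$, then $K(a,b)=0$. 2. If $\alpha$ is a real and $\beta$ a purely imaginary function of the system, then $$K(a,b)=\begin{cases}-\frac1{8\pi^2}&\text{if }|\alpha|\not\equiv|\beta|\text{ and }|\alpha|^2+|\beta|^2\not\equiv1,\\-\frac1{16\pi^2}&\text{if }|\alpha|^2+|\beta|^2\equiv1,\\-\frac3{16\pi^2}&\text{if }|\alpha|\equiv|\beta|\not\equiv1,\\-\frac1{8\pi^2}&\text{if }|\alpha|\equiv|\beta|\equiv1.\end{cases}$$ (The second case occurs exactly when one of $|\alpha|,|\beta|$ is $|\cos(kx+ly)|$ and the other is $|\sin(kx+ly)|$, with the same $(k,l)\ne(0,0)$.) 3. For every nonzero function $\alpha$ of the system, $K(a,\mathbf Ja)=-\frac3{16\pi^2}$ if $|\alpha|\not\equiv1$, and $K(a,\mathbf Ja)=-\frac1{8\pi^2}$ if $|\alpha|\equiv1$. 4. If $\alpha=e^{i(kx+ly)}$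 and $\beta=e^{i(px+qy)}$ with $(k,l)\ne(p,q)$, then $K(a,b)=-\frac1{16\pi^2}$. If $\alpha=e^{i(kx+ly)}$ and $\beta=\pm i\alpha$, then $K(a,b)=-\frac1{8\pi^2}$. **Sphere.** Let $S^2$ be the unit sphere with coordinates $(\varphi,z)\in U=(0,2\pi)\times(-1,1)$, i.e. the point $(\sqrt{1-z^2}\cos\varphi,\sqrt{1-z^2}\sin\varphi,z)$, and $\omega=d\varphi\wedge dz$. Let $g\in\mathcal{AM}(S^2)$ be arbitrary and $e_1,e_2$ a frame as above on $U$. Consider the nonzero functions $\cos(kz+l\varphi)$, $\sin(kz+l\varphi)$, $i\cos(kz+l\varphi)$, $i\sin(kz+l\varphi)$, $k\in\pi\mathbb Z$, $l\in\mathbb Z$. They define forms on $U$ that are smooth and bounded with respect to $g$ but possibly singular on the null set $S^2\setminus U$; their sectional curvatures are taken in the space of smooth associated metrics on $U$ that are uniformly equivalent to $g$, with the same weak Riemannian structure (integrals over $U$). Then 1, 2 and 3 hold with $\pi^2$ replaced by $\pi$ in every value: $K(a,b)=0$ in case 1; in case 2 the values are $-\frac1{8\pi}$, $-\frac1{16\pi}$,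 $-\frac3{16\pi}$, $-\frac1{8\pi}$ respectively (the conditions on $\alpha,\beta$ being the same); and in case 3 $K(a,\mathbf Ja)=-\frac3{16\pi}$ if $|\alpha|\not\equiv1$ and $-\frac1{8\pi}$ if $|\alpha|\equiv1$. -/

import Mathlib

open scoped Matrix ContDiff

noncomputable section

/-- Fields of real `2 × 2` matrices in two global coordinates `(x₀, x₁)`.  A symmetric `2`-form `a` is
stored through its Gram matrix, `a(X, Y) = Xᵀ a Y`; an endomorphism field through its matrix;
a frame through the matrix whose columns are the two frame vectors. -/
abbrev MatField : Type := ℝ × ℝ → Matrix (Fin 2) (Fin 2) ℝ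

/-- A surface with symplectic form `ω = dx₀ ∧ dx₁`, described by one coordinate chart: the set of
coordinates of its points (up to a null set) and the class of smooth functions. -/
structure CoordSurface where
  dom : Set (ℝ × ℝ)
  Smooth : (ℝ × ℝ → ℝ) → Prop

/-- The torus `ℝ² / 2πℤ²` with `ω = dx ∧ dy`: smooth functions are the smooth functions on the plane
that are `2π`-periodic in both variables; the domain is a fundamental domain. -/
def torus : CoordSurface where
  dom := Set.Ico 0 (2 * Real.pi) ×ˢ Set.Ico 0 (2 * Real.pi)
  Smooth f := ContDiff ℝ ∞ f ∧
    (∀ x y : ℝ, f (x + 2 * Real.pi, y) = f (x, y)) ∧ (∀ x y : ℝ, f (x, y + 2 * Real.pi) = f (x, y))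

/-- The coordinate domain `(φ, z) ∈ (0, 2π) × (-1, 1)` of the unit sphere (the sphere without a closed
half-meridian), with `ω = dφ ∧ dz`, which is the standard area form. -/
def sphereChart : CoordSurface where
  dom := Set.Ioo 0 (2 * Real.pi) ×ˢ Set.Ioo (-1) 1
  Smooth f := ContDiffOn ℝ ∞ f (Set.Ioo 0 (2 * Real.pi) ×ˢ Set.Ioo (-1) 1)

/-- A matrix field with smooth entries. -/
def SmoothField (S : CoordSurface) (A : MatField) : Prop :=
  ∀ i j, S.Smooth (fun x => A x i j)

/-- The Gram matrix of `ω = dx₀ ∧ dx₁`. -/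
def omegaMat : Matrix (Fin 2) (Fin 2) ℝ := !![0, 1; -1, 0]

/-- `g` is the inner product associated with `ω`: `g(X, Y) = ω(X, JY)` for a complex structure `J` with
`ω(JX, JY) = ω(X, Y)` and `ω(X, JX) > 0` for `X ≠ 0`. -/
def IsAssociatedAt (g : Matrix (Fin 2) (Fin 2) ℝ) : Prop :=
  g.PosDef ∧ ∃ J : Matrix (Fin 2) (Fin 2) ℝ,
    J * J = -1 ∧ Jᵀ * omegaMat * J = omegaMat ∧ g = omegaMat * J

/-- The space `AM` of smooth metrics on the chart that are associated with `ω`.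
For `torus` this is exactly `AM(T²)`. -/
def IsAssociatedMetric (S : CoordSurface) (g : MatField) : Prop :=
  SmoothField S g ∧ ∀ x ∈ S.dom, IsAssociatedAt (g x)

/-- The parametrization `(φ, z) ↦ (√(1-z²) cos φ, √(1-z²) sin φ, z)` of the unit sphere. -/
def spherePoint (φ z : ℝ) : Fin 3 → ℝ :=
  ![√(1 - z ^ 2) * Real.cos φ, √(1 - z ^ 2) * Real.sin φ, z]

/-- The `3 × 2` Jacobian matrix of `spherePoint`. -/
def sphereJacobian (φ z : ℝ) : Matrix (Fin 3) (Fin 2) ℝ :=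
  Matrix.of fun i =>
    ![deriv (fun s => spherePoint s z i) φ, deriv (fun s => spherePoint φ s i) z]

/-- `AM(S²)`: associated metrics that are, in the coordinates `(φ, z)`, a Riemannian metric that is
smooth on the whole sphere (the restriction to the tangent planes of the unit sphere of a smooth
field of symmetric bilinear forms on `ℝ³`, positive definite on these planes). -/
def IsAssociatedSphereMetric (g : MatField) : Prop :=
  IsAssociatedMetric sphereChart g ∧
  ∃ B : (Fin 3 → ℝ) → Matrix (Fin 3) (Fin 3) ℝ,
    (∀ i j, ContDiff ℝ ∞ (fun p => B p i j)) ∧ (∀ p, (B p).IsSymm) ∧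
    (∀ p v : Fin 3 → ℝ, p ⬝ᵥ p = 1 → p ⬝ᵥ v = 0 → v ≠ 0 → 0 < v ⬝ᵥ (B p *ᵥ v)) ∧
    ∀ x ∈ sphereChart.dom,
      g x = (sphereJacobian x.1 x.2)ᵀ * B (spherePoint x.1 x.2) * sphereJacobian x.1 x.2

/-- The almost complex structure of an associated metric: `g(X, Y) = ω(X, JY)`. -/
def acs (g : MatField) : MatField := fun x => omegaMat⁻¹ * g x

/-- The complex structure `a ↦ aJ` of the tangent space, `(aJ)(X, Y) = a(X, JY)`. -/
def compJ (g a : MatField) : MatField := fun x => a x * acs g x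

/-- The model space `End_SJ(TM)`: smooth endomorphism fields `P` with `PJ = -JP` and
`g(PX, Y) = g(X, PY)`, bounded with respect to `g`.  (Boundedness is automatic on the torus; on the
sphere chart it allows the bounded fields that do not extend smoothly to the removed null set.) -/
def IsModelField (S : CoordSurface) (g P : MatField) : Prop :=
  SmoothField S P ∧
  (∀ x ∈ S.dom, P x * acs g x = -(acs g x * P x) ∧ (g x * P x).IsSymm) ∧
  ∃ C : ℝ, ∀ x ∈ S.dom, (P x * P x).trace ≤ C

/-- The open domain of the model space on which `1 - P²` is (uniformly) positive with respect to `g`;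
on the torus uniformity is automatic by compactness. -/
def InChartDomain (S : CoordSurface) (g P : MatField) : Prop :=
  IsModelField S g P ∧
  ∃ ε : ℝ, 0 < ε ∧ ∀ x ∈ S.dom, (g x * (1 - P x * P x) - ε • g x).PosSemidef

/-- The global parametrization `P ↦ g (1 + P) (1 - P)⁻¹` of the space of associated metrics. -/
def cayleyChart (g P : MatField) : MatField := fun x => g x * (1 + P x) * (1 - P x)⁻¹

/-- The differential of the parametrization at `P` in the direction `A`. -/
def cayleyChartDeriv (g P A : MatField) : MatField := fun x =>
  Matrix.of fun i j => deriv (fun t : ℝ => cayleyChart g (P + t • A) x i j) 0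

/-- The weak Riemannian structure `(a, b)_g = ∫ tr (g⁻¹ a g⁻¹ b) dμ`; the Riemannian measure `μ` of an
associated metric is the one of `ω = dx₀ ∧ dx₁`, i.e. Lebesgue measure in the coordinates. -/
def weakInner (S : CoordSurface) (g a b : MatField) : ℝ :=
  ∫ x in S.dom, ((g x)⁻¹ * a x * (g x)⁻¹ * b x).trace

/-- The weak Riemannian structure in the parametrization `cayleyChart g`. -/
def chartMetric (S : CoordSurface) (g P A B : MatField) : ℝ :=
  weakInner S (cayleyChart g P) (cayleyChartDeriv g P A) (cayleyChartDeriv g P B)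

/-- `Γ` is the Christoffel map of the Levi-Civita connection in the parametrization: the connection
`∇_A B = d_A B + Γ_P(A, B)` is torsion free and compatible with the weak Riemannian structure. -/
structure IsLeviCivita (S : CoordSurface) (g : MatField)
    (Γ : MatField → MatField → MatField → MatField) : Prop where
  mem : ∀ P A B, InChartDomain S g P → IsModelField S g A → IsModelField S g B →
    IsModelField S g (Γ P A B)
  torsionFree : ∀ P A B, InChartDomain S g P → IsModelField S g A → IsModelField S g B →
    ∀ x ∈ S.dom, Γ P A B x = Γ P B A x
  compatible : ∀ P A B C, InChartDomain S g P → IsModelField S g A → IsModelField S g B →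
    IsModelField S g C →
    HasDerivAt (fun t : ℝ => chartMetric S g (P + t • C) A B)
      (chartMetric S g P (Γ P C A) B + chartMetric S g P A (Γ P C B)) 0

/-- `R` is the value `R(A, B)C = ∇_A ∇_B C - ∇_B ∇_A C` at the point `g` (that is, at `P = 0`) of the
curvature tensor of the connection `Γ`, for constant fields `A`, `B`, `C` of the parametrization. -/
def HasCurvature (S : CoordSurface) (Γ : MatField → MatField → MatField → MatField)
    (A B C R : MatField) : Prop :=
  ∃ D₁ D₂ : MatField,
    (∀ x ∈ S.dom, ∀ i j, HasDerivAt (fun t : ℝ => Γ (t • A) B C x i j) (D₁ x i j) 0) ∧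
    (∀ x ∈ S.dom, ∀ i j, HasDerivAt (fun t : ℝ => Γ (t • B) A C x i j) (D₂ x i j) 0) ∧
    R = D₁ + Γ 0 A (Γ 0 B C) - (D₂ + Γ 0 B (Γ 0 A C))

/-- `a` and `b` are tangent vectors at `g` to the space of associated metrics, they span a plane, and
`κ = (R(a, b)b, a) / ‖a ∧ b‖²` is the sectional curvature in this plane, computed from the
Levi-Civita connection in the parametrization centred at `g`. -/
def HasSectionalCurvature (S : CoordSurface) (g a b : MatField) (κ : ℝ) : Prop :=
  ∃ A B : MatField, IsModelField S g A ∧ IsModelField S g B ∧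
    (∀ x ∈ S.dom, cayleyChartDeriv g 0 A x = a x) ∧ (∀ x ∈ S.dom, cayleyChartDeriv g 0 B x = b x) ∧
    weakInner S g a a * weakInner S g b b - weakInner S g a b ^ 2 ≠ 0 ∧
    ∃ (Γ : MatField → MatField → MatField → MatField) (R : MatField),
      IsLeviCivita S g Γ ∧ HasCurvature S Γ A B B R ∧
      κ = chartMetric S g 0 R A /
        (weakInner S g a a * weakInner S g b b - weakInner S g a b ^ 2)

/-- The columns `e₁, e₂` of `F` form a smooth positively oriented `g`-orthonormal frame. -/
def IsOrthonormalFrame (S : CoordSurface) (g F : MatField) : Prop :=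
  SmoothField S F ∧ ∀ x ∈ S.dom, (F x)ᵀ * g x * F x = 1 ∧ 0 < (F x).det

/-- The symmetric `2`-form `α dw ⊗ dw + ᾱ dw̄ ⊗ dw̄ = 2 Re (α dw ⊗ dw)`, where `dw = e₁* + i e₂*` and
`e₁*, e₂*` is the coframe dual to `F`.  In the complex frame `(e₁ - i e₂)/2, (e₁ + i e₂)/2`
its matrix is `diag (α, ᾱ)`. -/
def formOf (F : MatField) (α : ℝ × ℝ → ℂ) : MatField := fun x =>
  Matrix.of fun i j =>
    2 * (α x * (((F x)⁻¹ 0 i : ℂ) + Complex.I * ((F x)⁻¹ 1 i : ℂ)) *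
      (((F x)⁻¹ 0 j : ℂ) + Complex.I * ((F x)⁻¹ 1 j : ℂ))).re

/-- The functions `cos (k s x₀ + l t x₁)` and `sin (k s x₀ + l t x₁)`, `k, l ∈ ℤ`. -/
def IsRealBasisFun (s t : ℝ) (α : ℝ × ℝ → ℂ) : Prop :=
  ∃ k l : ℤ,
    (α = fun x => ((Real.cos (k * s * x.1 + l * t * x.2) : ℝ) : ℂ)) ∨
    (α = fun x => ((Real.sin (k * s * x.1 + l * t * x.2) : ℝ) : ℂ))

/-- The functions `i cos (k s x₀ + l t x₁)` and `i sin (k s x₀ + l t x₁)`, `k, l ∈ ℤ`. -/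
def IsImagBasisFun (s t : ℝ) (α : ℝ × ℝ → ℂ) : Prop :=
  ∃ γ : ℝ × ℝ → ℂ, IsRealBasisFun s t γ ∧ α = fun x => Complex.I * γ x

/-- The exponential `e^{i(kx + ly)}`. -/
def expFun (k l : ℤ) : ℝ × ℝ → ℂ := fun x =>
  Complex.exp (Complex.I * (((k : ℝ) * x.1 + (l : ℝ) * x.2 : ℝ) : ℂ))

end

/-! The weak Riemannian structure contains no derivatives in the surface variable, so the geometry
is that of an integral, over the surface, of copies of one hyperbolic plane. In a positively
oriented orthonormal frame of `g`, a model endomorphism `P` is a traceless symmetric matrix, i.e. a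
planar vector. The Clifford relation `AB + BA = tr(AB) 1` (`IsModelAt.mul_add_mul`) makes `P²` the
scalar `tr P² / 2`. Hence the Cayley parametrization is rational with a scalar denominator, and
`IsModelAt.trace_metric` identifies the metric at a point as `4 (1 - tr P² / 2)⁻² tr(AB)`. With
`tr(AB) = 2⟨A, B⟩` this is twice the Poincaré disc metric, of curvature `-1/2`.

The Levi-Civita connection is therefore pointwise as well: `Γ_P(A, B) = 2 (1 - tr P² / 2)⁻¹ A P B`.
Its symmetry is `APB = BPA`, and its compatibility is the Clifford relation together with
differentiation under the integral sign (`christoffel_compatible`). Since `Γ_0 = 0`, the curvature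
at the centre is `R(A, B)B = 2BAB - 2ABB`, and `hasSectionalCurvature_formOf` gives `K(a, b) = -½ ∫
(Im αβ̄)² / (∫ |α|² ∫ |β|² - (∫ Re αβ̄)²)`. Neither the metric nor the frame appears in this
formula.

What remains is Fourier analysis on a domain of area `V`, with `V = 4π²` for the torus and `V = 4π`
for the sphere. If `α`, `β` are pointwise orthogonal, then with `p = |α|²`, `q = |β|²` the formula
becomes `K = -½ ∫ pq / (∫ p ∫ q)`. For the trigonometric system `p` and `q` have the form `(1 ± cos
2θ)/2`. They are uncorrelated, giving `-1/(2V)`, except when `p + q = 1`, where `∫ pq = V/8`, or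
when `p = q` is not constant, where `∫ pq = 3V/8` (`IsTrigSquare.integral_mul`,
`hasSectionalCurvature_of_orthogonal`). -/

/-! ### Linear algebra of `ω` and of adapted frames. -/

/-- The symmetric traceless `2 × 2` matrices. -/
def tracelessSymm (u v : ℝ) : Matrix (Fin 2) (Fin 2) ℝ := !![u, v; v, -u]

/-- The columns of `f` form a positively oriented orthonormal basis for the inner product `g`
associated with `ω`, and `J = ω⁻¹ g` is the rotation by a right angle in this basis. -/
structure IsFrameAt (g f : Matrix (Fin 2) (Fin 2) ℝ) : Prop where
  det_eq : f.det = 1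
  orthonormal : fᵀ * g * f = 1
  acs_eq : omegaMat⁻¹ * g = f * !![0, -1; 1, 0] * f⁻¹

/-- `P` is the value at a point of an element of the model space `End_SJ(TM)`. -/
def IsModelAt (g P : Matrix (Fin 2) (Fin 2) ℝ) : Prop :=
  P * (omegaMat⁻¹ * g) = -(omegaMat⁻¹ * g * P) ∧ (g * P).IsSymm

lemma omegaMat_inv : omegaMat⁻¹ = !![0, -1; 1, 0] := by
  apply Matrix.inv_eq_right_inv
  ext i j
  fin_cases i <;> fin_cases j <;> simp [omegaMat, Matrix.mul_apply]

lemma transpose_mul_omegaMat_mul (f : Matrix (Fin 2) (Fin 2) ℝ) :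
    fᵀ * omegaMat * f = f.det • omegaMat := by
  ext i j
  fin_cases i <;> fin_cases j <;>
    simp [omegaMat, Matrix.mul_apply, Matrix.det_fin_two, Fin.sum_univ_two] <;> ring

lemma mul_omegaMat_inv_mul_transpose (f : Matrix (Fin 2) (Fin 2) ℝ) :
    f * omegaMat⁻¹ * fᵀ = f.det • omegaMat⁻¹ := by
  rw [omegaMat_inv]
  ext i j
  fin_cases i <;> fin_cases j <;>
    simp [Matrix.mul_apply, Matrix.det_fin_two, Fin.sum_univ_two] <;> ring

lemma det_omegaMat : omegaMat.det = 1 := by simp [omegaMat, Matrix.det_fin_two]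

/-- In dimension two, `J` preserves `ω` exactly when `det J = 1`. -/
lemma IsAssociatedAt.det_eq_one {g : Matrix (Fin 2) (Fin 2) ℝ} (h : IsAssociatedAt g) :
    g.det = 1 := by
  obtain ⟨-, J, -, h2, rfl⟩ := h
  rw [transpose_mul_omegaMat_mul] at h2
  have := congrFun (congrFun h2 0) 1
  simp [omegaMat] at this
  rw [Matrix.det_mul, det_omegaMat, this, one_mul]

/-- As `det g = 1`, orthonormality forces `det f = ±1`, and the orientation selects `1`. Thus `f` is
symplectic, and it carries the standard rotation to `J`. -/
lemma IsAssociatedAt.isFrameAt {g f : Matrix (Fin 2) (Fin 2) ℝ} (h : IsAssociatedAt g)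
    (hf : fᵀ * g * f = 1) (hdet : 0 < f.det) : IsFrameAt g f := by
  have hd : f.det = 1 := by
    have := congrArg Matrix.det hf
    rw [Matrix.det_mul, Matrix.det_mul, Matrix.det_transpose, h.det_eq_one, Matrix.det_one] at this
    nlinarith
  refine ⟨hd, hf, ?_⟩
  have hu : IsUnit f.det := by simp [hd]
  have hut : IsUnit (fᵀ).det := by simp [hd]
  rw [← omegaMat_inv]
  have h2 : g = (fᵀ)⁻¹ * f⁻¹ := by
    have : (fᵀ)⁻¹ * (fᵀ * g * f) * f⁻¹ = g := by
      rw [Matrix.mul_assoc fᵀ, Matrix.nonsing_inv_mul_cancel_left _ _ hut,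
        Matrix.mul_nonsing_inv_cancel_right _ _ hu]
    rw [← this, hf, Matrix.mul_one]
  -- The factor `1` is inserted as `det f`, so that `det f • ω⁻¹` can be replaced by `f ω⁻¹ fᵀ`.
  rw [h2, ← Matrix.mul_assoc, ← one_smul ℝ (omegaMat⁻¹ * _), ← hd, ← Matrix.smul_mul,
    ← mul_omegaMat_inv_mul_transpose, Matrix.mul_nonsing_inv_cancel_right _ _ hut]

/-! ### Algebra of the model space at a point. -/

section Pointwise

variable {g f P A B : Matrix (Fin 2) (Fin 2) ℝ}

namespace IsFrameAt

lemma isUnit_det (h : IsFrameAt g f) : IsUnit f.det := by simp [h.det_eq]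

lemma mul_eq (h : IsFrameAt g f) : g * f = (f⁻¹)ᵀ := by
  have hut : IsUnit (fᵀ).det := by simp [h.det_eq]
  rw [Matrix.transpose_nonsing_inv, ← Matrix.mul_one (fᵀ)⁻¹, ← h.orthonormal, Matrix.mul_assoc fᵀ,
    Matrix.nonsing_inv_mul_cancel_left _ _ hut]

lemma eq_inv (h : IsFrameAt g f) : g = (f⁻¹)ᵀ * f⁻¹ := by
  rw [← h.mul_eq, Matrix.mul_nonsing_inv_cancel_right _ _ h.isUnit_det]

lemma isUnit_det_metric (h : IsFrameAt g f) : IsUnit g.det := by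
  rw [h.eq_inv, Matrix.det_mul, Matrix.det_transpose, Matrix.det_nonsing_inv, h.det_eq]
  simp

lemma conj_mul (h : IsFrameAt g f) (p q : Matrix (Fin 2) (Fin 2) ℝ) :
    f * p * f⁻¹ * (f * q * f⁻¹) = f * (p * q) * f⁻¹ := by
  simp only [Matrix.mul_assoc, Matrix.nonsing_inv_mul_cancel_left _ _ h.isUnit_det]

lemma trace_conj (h : IsFrameAt g f) (p : Matrix (Fin 2) (Fin 2) ℝ) :
    (f * p * f⁻¹).trace = p.trace := by
  rw [Matrix.trace_mul_comm, Matrix.nonsing_inv_mul_cancel_left _ _ h.isUnit_det]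

lemma conj_injective (h : IsFrameAt g f) {p q : Matrix (Fin 2) (Fin 2) ℝ}
    (e : f * p * f⁻¹ = f * q * f⁻¹) : p = q := by
  have := congrArg (fun m => f⁻¹ * m * f) e
  simpa only [Matrix.mul_assoc, Matrix.nonsing_inv_mul_cancel_left _ _ h.isUnit_det,
    Matrix.nonsing_inv_mul _ h.isUnit_det, Matrix.mul_one] using this

lemma isModelAt_conj (h : IsFrameAt g f) (u v : ℝ) :
    IsModelAt g (f * tracelessSymm u v * f⁻¹) := by
  constructor
  · rw [h.acs_eq, h.conj_mul, h.conj_mul, ← Matrix.neg_mul, ← Matrix.mul_neg]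
    congr 2
    ext i j
    fin_cases i <;> fin_cases j <;> simp [tracelessSymm]
  · have ht : (tracelessSymm u v)ᵀ = tracelessSymm u v := by
      ext i j
      fin_cases i <;> fin_cases j <;> simp [tracelessSymm]
    rw [← Matrix.mul_assoc, ← Matrix.mul_assoc, h.mul_eq, Matrix.IsSymm]
    simp only [Matrix.transpose_mul, Matrix.transpose_transpose, ht, Matrix.mul_assoc]

/-- Anticommuting with the rotation by a right angle forces a `2 × 2` matrix to be symmetric and
traceless. The pointwise identities below are thereby reduced to identities in the coordinates `(u,
v)`. -/
lemma exists_eq_conj (h : IsFrameAt g f) (hP : IsModelAt g P) :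
    ∃ u v, P = f * tracelessSymm u v * f⁻¹ := by
  have hu := h.isUnit_det
  obtain ⟨p, rfl⟩ : ∃ p, P = f * p * f⁻¹ := ⟨f⁻¹ * P * f, by
    simp only [Matrix.mul_assoc, Matrix.mul_nonsing_inv_cancel_left _ _ hu,
      Matrix.mul_nonsing_inv _ hu, Matrix.mul_one]⟩
  have h1 := hP.1
  rw [h.acs_eq, h.conj_mul, h.conj_mul, ← Matrix.neg_mul, ← Matrix.mul_neg] at h1
  have h2 := h.conj_injective h1
  refine ⟨p 0 0, p 0 1, ?_⟩
  congr 2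
  have e0 := congrFun (congrFun h2 0) 0
  have e1 := congrFun (congrFun h2 0) 1
  simp [Matrix.mul_apply, Matrix.vecMul, dotProduct, Fin.sum_univ_two] at e0 e1
  ext i j
  fin_cases i <;> fin_cases j <;> simp [tracelessSymm] <;> linarith

end IsFrameAt

lemma tracelessSymm_mul (u v u' v' : ℝ) : tracelessSymm u v * tracelessSymm u' v' =
    !![u * u' + v * v', u * v' - v * u'; v * u' - u * v', v * v' + u * u'] := by
  ext i j
  fin_cases i <;> fin_cases j <;> simp [tracelessSymm] <;> ring

/-- With `z = u + iv` the triple product is `z z̄' z''`. This explains its closure, its symmetry in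
the outer factors and the multiplicativity of its norm. -/
lemma tracelessSymm_mul_mul (u v u' v' u'' v'' : ℝ) :
    tracelessSymm u v * tracelessSymm u' v' * tracelessSymm u'' v'' =
    tracelessSymm ((u * u' + v * v') * u'' + (u * v' - v * u') * v'')
      ((u * u' + v * v') * v'' - (u * v' - v * u') * u'') := by
  rw [tracelessSymm_mul]
  ext i j
  fin_cases i <;> fin_cases j <;> simp [tracelessSymm] <;> ring

lemma trace_tracelessSymm_mul (u v u' v' : ℝ) :
    (tracelessSymm u v * tracelessSymm u' v').trace = 2 * (u * u' + v * v') := by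
  rw [tracelessSymm_mul]
  simp [Matrix.trace_fin_two]
  ring

namespace IsModelAt

lemma add (hA : IsModelAt g A) (hB : IsModelAt g B) : IsModelAt g (A + B) := by
  refine ⟨?_, ?_⟩
  · rw [Matrix.add_mul, Matrix.mul_add, hA.1, hB.1, neg_add]
  · rw [Matrix.mul_add]
    exact hA.2.add hB.2

lemma smul (c : ℝ) (hA : IsModelAt g A) : IsModelAt g (c • A) := by
  refine ⟨?_, ?_⟩
  · rw [Matrix.smul_mul, Matrix.mul_smul, hA.1, smul_neg]
  · rw [Matrix.mul_smul]
    exact hA.2.smul c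

lemma zero : IsModelAt g 0 := by simp [IsModelAt, Matrix.isSymm_zero]

lemma mul_mul (h : IsFrameAt g f) (hA : IsModelAt g A) (hP : IsModelAt g P) (hB : IsModelAt g B) :
    IsModelAt g (A * P * B) := by
  obtain ⟨a, a', rfl⟩ := h.exists_eq_conj hA
  obtain ⟨b, b', rfl⟩ := h.exists_eq_conj hB
  obtain ⟨p, p', rfl⟩ := h.exists_eq_conj hP
  rw [h.conj_mul, h.conj_mul, tracelessSymm_mul_mul]
  exact h.isModelAt_conj _ _

lemma mul_mul_comm (h : IsFrameAt g f) (hA : IsModelAt g A) (hP : IsModelAt g P)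
    (hB : IsModelAt g B) : A * P * B = B * P * A := by
  obtain ⟨a, a', rfl⟩ := h.exists_eq_conj hA
  obtain ⟨b, b', rfl⟩ := h.exists_eq_conj hB
  obtain ⟨p, p', rfl⟩ := h.exists_eq_conj hP
  simp only [h.conj_mul, tracelessSymm_mul_mul]
  congr 3 <;> ring

lemma trace_mul_mul_sq (h : IsFrameAt g f) (hA : IsModelAt g A) (hP : IsModelAt g P)
    (hB : IsModelAt g B) : 4 * ((A * P * B) * (A * P * B)).trace =
      (A * A).trace * (P * P).trace * (B * B).trace := by
  obtain ⟨a, a', rfl⟩ := h.exists_eq_conj hA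
  obtain ⟨b, b', rfl⟩ := h.exists_eq_conj hB
  obtain ⟨p, p', rfl⟩ := h.exists_eq_conj hP
  simp only [h.conj_mul, tracelessSymm_mul_mul, h.trace_conj, trace_tracelessSymm_mul]
  ring

/-- The Clifford relation, i.e. the polarized Cayley–Hamilton identity for traceless matrices. -/
lemma mul_add_mul (h : IsFrameAt g f) (hA : IsModelAt g A) (hB : IsModelAt g B) :
    A * B + B * A = (A * B).trace • 1 := by
  obtain ⟨a, a', rfl⟩ := h.exists_eq_conj hA
  obtain ⟨b, b', rfl⟩ := h.exists_eq_conj hB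
  have e : tracelessSymm a a' * tracelessSymm b b' + tracelessSymm b b' * tracelessSymm a a' =
      (tracelessSymm a a' * tracelessSymm b b').trace • 1 := by
    rw [trace_tracelessSymm_mul, tracelessSymm_mul, tracelessSymm_mul]
    ext i j
    fin_cases i <;> fin_cases j <;> simp <;> ring
  rw [h.conj_mul, h.conj_mul, ← Matrix.add_mul, ← Matrix.mul_add, e, h.trace_conj,
    Matrix.mul_smul, Matrix.smul_mul, Matrix.mul_one, Matrix.mul_nonsing_inv _ h.isUnit_det]

lemma mul_self (h : IsFrameAt g f) (hA : IsModelAt g A) : A * A = ((A * A).trace / 2) • 1 := by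
  have := mul_add_mul h hA hA
  rw [← two_smul ℝ (A * A)] at this
  rw [div_eq_inv_mul, mul_smul, ← this, smul_smul]
  norm_num

lemma trace_mul_self_nonneg (h : IsFrameAt g f) (hA : IsModelAt g A) : 0 ≤ (A * A).trace := by
  obtain ⟨a, a', rfl⟩ := h.exists_eq_conj hA
  rw [h.conj_mul, h.trace_conj, trace_tracelessSymm_mul]
  nlinarith [sq_nonneg a, sq_nonneg a']

lemma trace_mul_sq_le (h : IsFrameAt g f) (hA : IsModelAt g A) (hB : IsModelAt g B) :
    (A * B).trace ^ 2 ≤ (A * A).trace * (B * B).trace := by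
  obtain ⟨a, a', rfl⟩ := h.exists_eq_conj hA
  obtain ⟨b, b', rfl⟩ := h.exists_eq_conj hB
  simp only [h.conj_mul, h.trace_conj, trace_tracelessSymm_mul]
  nlinarith [sq_nonneg (a * b' - a' * b)]

lemma abs_trace_mul_le (h : IsFrameAt g f) (hA : IsModelAt g A) (hB : IsModelAt g B) :
    |(A * B).trace| ≤ (A * A).trace + (B * B).trace := by
  have h1 := trace_mul_sq_le h hA hB
  have h2 := trace_mul_self_nonneg h hA
  have h3 := trace_mul_self_nonneg h hB
  apply abs_le_of_sq_le_sq _ (by positivity)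
  nlinarith [mul_nonneg h2 h3]

/-- The inverse of `1 - P`. -/
lemma one_sub_inv (h : IsFrameAt g f) (hP : IsModelAt g P) (hr : (P * P).trace < 2) :
    (1 - P)⁻¹ = (1 - (P * P).trace / 2)⁻¹ • (1 + P) := by
  apply Matrix.inv_eq_right_inv
  rw [Matrix.mul_smul]
  have : (1 - P) * (1 + P) = (1 - (P * P).trace / 2) • 1 := by
    rw [sub_smul, one_smul, ← mul_self h hP]
    noncomm_ring
  rw [this, smul_smul, inv_mul_cancel₀ (by linarith), one_smul]

end IsModelAt

end Pointwise

/-! ### The Cayley parametrization and the metric at a point. -/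

section Pointwise

variable {g f P A B : Matrix (Fin 2) (Fin 2) ℝ}

namespace IsModelAt

/-- The value of the parametrization at a point. -/
lemma cayley_eq (h : IsFrameAt g f) (hP : IsModelAt g P) (hr : (P * P).trace < 2) :
    g * (1 + P) * (1 - P)⁻¹ =
      (1 - (P * P).trace / 2)⁻¹ • ((1 + (P * P).trace / 2) • g + (2 : ℝ) • (g * P)) := by
  rw [one_sub_inv h hP hr, Matrix.mul_smul, Matrix.mul_assoc]
  congr 1
  have : (1 + P) * (1 + P) = (1 + (P * P).trace / 2) • 1 + (2 : ℝ) • P := by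
    rw [add_smul, one_smul, ← mul_self h hP, two_smul]
    noncomm_ring
  rw [this, Matrix.mul_add, Matrix.mul_smul, Matrix.mul_smul, Matrix.mul_one]

lemma trace_add_smul_mul_self (P A : Matrix (Fin 2) (Fin 2) ℝ) (t : ℝ) :
    ((P + t • A) * (P + t • A)).trace =
      (P * P).trace + t * (2 * (P * A).trace) + t ^ 2 * (A * A).trace := by
  simp only [Matrix.add_mul, Matrix.mul_add, Matrix.trace_add, Matrix.smul_mul, Matrix.mul_smul,
    Matrix.trace_smul, smul_eq_mul, Matrix.trace_mul_comm A P]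
  ring

lemma hasDerivAt_trace (P A : Matrix (Fin 2) (Fin 2) ℝ) (t : ℝ) :
    HasDerivAt (fun t : ℝ => ((P + t • A) * (P + t • A)).trace)
      (2 * (P * A).trace + 2 * t * (A * A).trace) t := by
  simp only [trace_add_smul_mul_self]
  have h1 := (((hasDerivAt_id t).mul_const (2 * (P * A).trace)).const_add (P * P).trace).add
    ((hasDerivAt_pow 2 t).mul_const (A * A).trace)
  exact h1.congr_deriv (by simp)

/-- The Clifford relation gives `PAP = tr(PA) P - (tr P² / 2) A`. The result is the shape in which
the derivative of the rational expression in `cayley_eq` appears. -/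
lemma mul_mul_one_add (h : IsFrameAt g f) (hP : IsModelAt g P) (hA : IsModelAt g A) :
    (1 + P) * A * (1 + P) =
      (P * A).trace • (1 + P) + (1 - (P * P).trace / 2) • A := by
  have e1 := mul_add_mul h hP hA
  have e2 : P * A * P = (P * A).trace • P - ((P * P).trace / 2) • A := by
    have : P * A * P = (P * A + A * P) * P - A * (P * P) := by noncomm_ring
    rw [this, e1, mul_self h hP, Matrix.smul_mul, Matrix.one_mul, Matrix.mul_smul, Matrix.mul_one]
    congr 2
    simp
  have : (1 + P) * A * (1 + P) = A + (P * A + A * P) + P * A * P := by noncomm_ring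
  rw [this, e1, e2, smul_add, sub_smul, one_smul]
  abel

/-- The differential of the parametrization at a point. -/
lemma hasDerivAt_cayley (h : IsFrameAt g f) (hP : IsModelAt g P) (hA : IsModelAt g A)
    (hr : (P * P).trace < 2) (i j : Fin 2) :
    HasDerivAt (fun t : ℝ => (g * (1 + (P + t • A)) * (1 - (P + t • A))⁻¹) i j)
      (((2 / (1 - (P * P).trace / 2) ^ 2) • (g * ((1 + P) * A * (1 + P))) :
        Matrix (Fin 2) (Fin 2) ℝ) i j) 0 := by
  have hd := hasDerivAt_trace P A 0
  -- The closed form of `cayley_eq` holds only where the trace is below `2`, an open condition on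
  -- `t`.
  have hev : ∀ᶠ t in nhds (0 : ℝ), ((P + t • A) * (P + t • A)).trace < 2 :=
    hd.continuousAt.eventually_lt continuousAt_const (by simpa using hr)
  have hne : 1 - (P * P).trace / 2 ≠ 0 := by linarith
  have hq : HasDerivAt (fun t : ℝ => (1 - ((P + t • A) * (P + t • A)).trace / 2)⁻¹)
      ((P * A).trace / (1 - (P * P).trace / 2) ^ 2) 0 := by
    have := ((hd.div_const 2).const_sub 1).inv (by simpa using hne)
    exact this.congr_deriv (by simp)
  have hl : HasDerivAt (fun t : ℝ => (1 + ((P + t • A) * (P + t • A)).trace / 2) * g i j +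
      2 * ((g * P) i j + t * (g * A) i j)) ((P * A).trace * g i j + 2 * (g * A) i j) 0 := by
    have := (((hd.div_const 2).const_add 1).mul_const (g i j)).add
      ((((hasDerivAt_id (0 : ℝ)).mul_const ((g * A) i j)).const_add ((g * P) i j)).const_mul 2)
    exact this.congr_deriv (by simp)
  refine ((hq.mul hl).congr_of_eventuallyEq ?_).congr_deriv ?_
  · filter_upwards [hev] with t ht
    rw [cayley_eq h (hP.add (hA.smul t)) ht]
    simp only [Matrix.mul_add, Matrix.mul_smul, Matrix.add_apply, Matrix.smul_apply, smul_eq_mul,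
      Pi.mul_apply]
  -- The claimed derivative is `2 g (1 - P)⁻¹ A (1 - P)⁻¹`, with each inverse written as `(1 + P)`
  -- over the scalar `1 - tr P² / 2`.
  · rw [mul_mul_one_add h hP hA]
    simp [Matrix.mul_add]
    field_simp
    ring

/-- The weak Riemannian structure in the parametrization, at a point. -/
lemma trace_metric (h : IsFrameAt g f) (hP : IsModelAt g P) (hr : (P * P).trace < 2) :
    ((g * (1 + P) * (1 - P)⁻¹)⁻¹ *
        ((2 / (1 - (P * P).trace / 2) ^ 2) • (g * ((1 + P) * A * (1 + P)))) *
        (g * (1 + P) * (1 - P)⁻¹)⁻¹ *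
        ((2 / (1 - (P * P).trace / 2) ^ 2) • (g * ((1 + P) * B * (1 + P))))).trace =
      4 * ((1 - (P * P).trace / 2)⁻¹) ^ 2 * (A * B).trace := by
  have hne : 1 - (P * P).trace / 2 ≠ 0 := by linarith
  set q := 1 - (P * P).trace / 2 with hq
  have hmp : (1 - P) * (1 + P) = q • 1 := by
    rw [hq, sub_smul, one_smul, ← mul_self h hP]
    noncomm_ring
  have hpm : (1 + P) * (1 - P) = q • 1 := by
    rw [← hmp]
    noncomm_ring
  have hinv : (g * (1 + P) * (1 - P)⁻¹)⁻¹ = q⁻¹ • ((1 - P) * (1 - P) * g⁻¹) := by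
    apply Matrix.inv_eq_left_inv
    rw [one_sub_inv h hP hr, Matrix.smul_mul]
    simp only [Matrix.mul_assoc, Matrix.mul_smul,
      Matrix.nonsing_inv_mul_cancel_left _ _ h.isUnit_det_metric]
    rw [← Matrix.mul_assoc (1 - P) (1 + P), hmp]
    simp only [Matrix.smul_mul, Matrix.mul_smul, Matrix.one_mul, hmp, smul_smul]
    rw [← hq, show q⁻¹ * (q⁻¹ * (q * q)) = 1 by field_simp, one_smul]
  -- Up to a scalar the right side is the conjugate `(1 - P) X (1 - P)⁻¹`, so the trace of a product
  -- of two such factors sees only `tr(AB)`.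
  have hX : ∀ X : Matrix (Fin 2) (Fin 2) ℝ, (g * (1 + P) * (1 - P)⁻¹)⁻¹ *
      ((2 / q ^ 2) • (g * ((1 + P) * X * (1 + P)))) =
      (2 / q ^ 2) • ((1 - P) * X * (1 + P)) := by
    intro X
    rw [hinv]
    simp only [Matrix.mul_assoc, Matrix.mul_smul, Matrix.smul_mul,
      Matrix.nonsing_inv_mul_cancel_left _ _ h.isUnit_det_metric]
    rw [← Matrix.mul_assoc (1 - P) (1 + P), hmp]
    simp only [Matrix.smul_mul, Matrix.mul_smul, Matrix.one_mul, smul_smul]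
    congr 1
    field_simp
  rw [hX, Matrix.mul_assoc, hX]
  simp only [Matrix.mul_smul, Matrix.smul_mul, Matrix.trace_smul, smul_eq_mul]
  have : (1 - P) * A * (1 + P) * ((1 - P) * B * (1 + P)) =
      q • ((1 - P) * (A * B * (1 + P))) := by
    have : (1 - P) * A * (1 + P) * ((1 - P) * B * (1 + P)) =
      (1 - P) * A * (((1 + P) * (1 - P)) * (B * (1 + P))) := by
      simp only [Matrix.mul_assoc]
    rw [this, hpm]
    simp only [Matrix.smul_mul, Matrix.mul_smul, Matrix.one_mul, Matrix.mul_assoc]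
  rw [this, Matrix.trace_smul, Matrix.trace_mul_comm, Matrix.mul_assoc, hpm]
  simp only [Matrix.mul_smul, Matrix.mul_one, Matrix.trace_smul, smul_eq_mul]
  field_simp
  ring

end IsModelAt

end Pointwise

/-! ### Smooth bounded functions on the two coordinate surfaces. -/

open MeasureTheory

namespace CoordSurface

/-- The closure properties of the smooth functions and of the domain used below. -/
structure IsRegular (S : CoordSurface) : Prop where
  const : ∀ c : ℝ, S.Smooth fun _ => c
  add : ∀ {f h : ℝ × ℝ → ℝ}, S.Smooth f → S.Smooth h → S.Smooth fun x => f x + h x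
  mul : ∀ {f h : ℝ × ℝ → ℝ}, S.Smooth f → S.Smooth h → S.Smooth fun x => f x * h x
  inv : ∀ {f : ℝ × ℝ → ℝ} {ε : ℝ}, S.Smooth f → 0 < ε → (∀ x ∈ S.dom, ε ≤ f x) →
    S.Smooth fun x => (f x)⁻¹
  continuousOn : ∀ {f : ℝ × ℝ → ℝ}, S.Smooth f → ContinuousOn f S.dom
  measurableSet : MeasurableSet S.dom
  volume_ne_top : volume S.dom ≠ ⊤

lemma isRegular_sphereChart : sphereChart.IsRegular where
  const c := contDiffOn_const
  add hf hg := ContDiffOn.add hf hg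
  mul hf hg := ContDiffOn.mul hf hg
  inv hf hε h := ContDiffOn.inv hf fun x hx => (hε.trans_le (h x hx)).ne'
  continuousOn hf := ContDiffOn.continuousOn hf
  measurableSet := measurableSet_Ioo.prod measurableSet_Ioo
  volume_ne_top := by
    simp only [sphereChart, Measure.volume_eq_prod, Measure.prod_prod, Real.volume_Ioo]
    exact ENNReal.mul_ne_top ENNReal.ofReal_ne_top ENNReal.ofReal_ne_top

/-- Lower bounds are known on the fundamental domain only, while smoothness of an inverse is
required on the whole plane; periodicity bridges the two. -/
lemma exists_mem_torus_dom {f : ℝ × ℝ → ℝ} (hf : torus.Smooth f) (x : ℝ × ℝ) :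
    ∃ y ∈ torus.dom, f x = f y := by
  have hp := Real.two_pi_pos
  have h1 : ∀ y, Function.Periodic (fun x => f (x, y)) (2 * Real.pi) := fun y x => hf.2.1 x y
  have h2 : ∀ x, Function.Periodic (fun y => f (x, y)) (2 * Real.pi) := fun x y => hf.2.2 x y
  obtain ⟨a, ha, ea⟩ := (h1 x.2).exists_mem_Ico₀ hp x.1
  obtain ⟨b, hb, eb⟩ := (h2 a).exists_mem_Ico₀ hp x.2
  exact ⟨(a, b), ⟨ha, hb⟩, ea.trans eb⟩

lemma isRegular_torus : torus.IsRegular where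
  const c := ⟨contDiff_const, by simp, by simp⟩
  add hf hg := ⟨hf.1.add hg.1, fun x y => by simp only [hf.2.1 x y, hg.2.1 x y],
    fun x y => by simp only [hf.2.2 x y, hg.2.2 x y]⟩
  mul hf hg := ⟨hf.1.mul hg.1, fun x y => by simp only [hf.2.1 x y, hg.2.1 x y],
    fun x y => by simp only [hf.2.2 x y, hg.2.2 x y]⟩
  inv hf hε h := ⟨hf.1.inv fun x => by
      obtain ⟨y, hy, e⟩ := exists_mem_torus_dom hf x
      rw [e]
      exact (hε.trans_le (h y hy)).ne',
    fun x y => by simp only [hf.2.1 x y], fun x y => by simp only [hf.2.2 x y]⟩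
  continuousOn hf := hf.1.continuous.continuousOn
  measurableSet := measurableSet_Ico.prod measurableSet_Ico
  volume_ne_top := by
    simp only [torus, Measure.volume_eq_prod, Measure.prod_prod, Real.volume_Ico]
    exact ENNReal.mul_ne_top ENNReal.ofReal_ne_top ENNReal.ofReal_ne_top

/-- Smooth functions that are bounded on the domain. -/
def SmoothBdd (S : CoordSurface) (f : ℝ × ℝ → ℝ) : Prop :=
  S.Smooth f ∧ ∃ C, ∀ x ∈ S.dom, |f x| ≤ C

variable {S : CoordSurface} {f h : ℝ × ℝ → ℝ}

lemma IsRegular.smoothBdd_const (hS : S.IsRegular) (c : ℝ) : S.SmoothBdd fun _ => c :=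
  ⟨hS.const c, |c|, fun _ _ => le_rfl⟩

lemma SmoothBdd.add (hS : S.IsRegular) (hf : S.SmoothBdd f) (hh : S.SmoothBdd h) :
    S.SmoothBdd fun x => f x + h x := by
  obtain ⟨hf, C, hC⟩ := hf
  obtain ⟨hh, D, hD⟩ := hh
  exact ⟨hS.add hf hh, C + D, fun x hx => (abs_add_le _ _).trans (add_le_add (hC x hx) (hD x hx))⟩

lemma SmoothBdd.mul (hS : S.IsRegular) (hf : S.SmoothBdd f) (hh : S.SmoothBdd h) :
    S.SmoothBdd fun x => f x * h x := by
  obtain ⟨hf, C, hC⟩ := hf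
  obtain ⟨hh, D, hD⟩ := hh
  refine ⟨hS.mul hf hh, C * D, fun x hx => ?_⟩
  rw [abs_mul]
  exact mul_le_mul (hC x hx) (hD x hx) (abs_nonneg _) ((abs_nonneg _).trans (hC x hx))

lemma SmoothBdd.const_mul (hS : S.IsRegular) (c : ℝ) (hf : S.SmoothBdd f) :
    S.SmoothBdd fun x => c * f x := (hS.smoothBdd_const c).mul hS hf

lemma SmoothBdd.pow (hS : S.IsRegular) (hf : S.SmoothBdd f) (n : ℕ) :
    S.SmoothBdd fun x => f x ^ n := by
  induction n with
  | zero => simpa using hS.smoothBdd_const 1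
  | succ n ih => simpa only [pow_succ] using ih.mul hS hf

lemma IsRegular.smoothBdd_inv (hS : S.IsRegular) (hf : S.Smooth f) {ε : ℝ} (hε : 0 < ε)
    (hle : ∀ x ∈ S.dom, ε ≤ f x) : S.SmoothBdd fun x => (f x)⁻¹ := by
  refine ⟨hS.inv hf hε hle, ε⁻¹, fun x hx => ?_⟩
  rw [abs_inv, abs_of_pos (hε.trans_le (hle x hx))]
  exact inv_anti₀ hε (hle x hx)

lemma IsRegular.isFiniteMeasure (hS : S.IsRegular) :
    IsFiniteMeasure ((volume : Measure (ℝ × ℝ)).restrict S.dom) :=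
  isFiniteMeasure_restrict.mpr hS.volume_ne_top

lemma IsRegular.aestronglyMeasurable (hS : S.IsRegular) (hf : S.Smooth f) :
    AEStronglyMeasurable f (volume.restrict S.dom) :=
  (hS.continuousOn hf).aestronglyMeasurable hS.measurableSet

lemma SmoothBdd.integrableOn (hS : S.IsRegular) (hf : S.SmoothBdd f) : IntegrableOn f S.dom := by
  have := hS.isFiniteMeasure
  obtain ⟨hf, C, hC⟩ := hf
  refine Integrable.of_bound (hS.aestronglyMeasurable hf) C ?_
  filter_upwards [ae_restrict_mem hS.measurableSet] with x hx using hC x hx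

end CoordSurface

open CoordSurface


/-! ### The weak metric in the parametrization and its Levi-Civita connection. -/

section Fields

variable {S : CoordSurface} {g F P A B C : MatField}

lemma SmoothField.mul (hS : S.IsRegular) (hA : SmoothField S A) (hB : SmoothField S B) :
    SmoothField S fun x => A x * B x := by
  intro i j
  simp only [Matrix.mul_apply, Fin.sum_univ_two]
  exact hS.add (hS.mul (hA _ _) (hB _ _)) (hS.mul (hA _ _) (hB _ _))

lemma SmoothField.add (hS : S.IsRegular) (hA : SmoothField S A) (hB : SmoothField S B) :
    SmoothField S (A + B) := fun i j => hS.add (hA i j) (hB i j)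

lemma SmoothField.smul (hS : S.IsRegular) {q : ℝ × ℝ → ℝ} (hq : S.Smooth q)
    (hA : SmoothField S A) : SmoothField S fun x => q x • A x := fun i j => hS.mul hq (hA i j)

lemma SmoothField.const_smul (hS : S.IsRegular) (c : ℝ) (hA : SmoothField S A) :
    SmoothField S (c • A) := hA.smul hS (hS.const c)

lemma SmoothField.trace (hS : S.IsRegular) (hA : SmoothField S A) :
    S.Smooth fun x => (A x).trace := by
  simp only [Matrix.trace_fin_two]
  exact hS.add (hA 0 0) (hA 1 1)

/-- `F` is an oriented orthonormal frame of `g` at every point of the domain. -/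
def IsFrameOn (S : CoordSurface) (g F : MatField) : Prop := ∀ x ∈ S.dom, IsFrameAt (g x) (F x)

lemma IsOrthonormalFrame.isFrameOn (hF : IsOrthonormalFrame S g F) (hg : IsAssociatedMetric S g) :
    IsFrameOn S g F := fun x hx => (hg.2 x hx).isFrameAt (hF.2 x hx).1 (hF.2 x hx).2

lemma IsModelField.isModelAt (hA : IsModelField S g A) {x : ℝ × ℝ} (hx : x ∈ S.dom) :
    IsModelAt (g x) (A x) := hA.2.1 x hx

lemma IsModelField.smoothBdd_trace_mul (hS : S.IsRegular) (hF : IsFrameOn S g F)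
    (hA : IsModelField S g A) (hB : IsModelField S g B) :
    S.SmoothBdd fun x => (A x * B x).trace := by
  obtain ⟨C, hC⟩ := hA.2.2
  obtain ⟨D, hD⟩ := hB.2.2
  exact ⟨(hA.1.mul hS hB.1).trace hS, C + D, fun x hx =>
    (IsModelAt.abs_trace_mul_le (hF x hx) (hA.isModelAt hx) (hB.isModelAt hx)).trans
      (add_le_add (hC x hx) (hD x hx))⟩

/-- Since `1 - P²` is scalar, in the frame the semidefiniteness condition is a multiple of the
identity, and one diagonal entry gives the numerical bound. -/
lemma InChartDomain.exists_trace_le (hF : IsFrameOn S g F) (hP : InChartDomain S g P) :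
    ∃ ε, 0 < ε ∧ ∀ x ∈ S.dom, ε ≤ 1 - (P x * P x).trace / 2 := by
  obtain ⟨hP, ε, hε, h⟩ := hP
  refine ⟨ε, hε, fun x hx => ?_⟩
  have h1 := (h x hx).conjTranspose_mul_mul_same (F x)
  have e : ∀ c : ℝ, P x * P x = c • 1 →
      (F x)ᴴ * (g x * (1 - P x * P x) - ε • g x) * F x = (1 - c - ε) • 1 := by
    intro c hc
    rw [hc, ← (hF x hx).orthonormal, Matrix.conjTranspose_eq_transpose_of_trivial]
    simp only [sub_smul, one_smul, Matrix.mul_sub, Matrix.mul_one, Matrix.mul_smul, Matrix.sub_mul,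
      Matrix.smul_mul, (hF x hx).orthonormal]
  rw [e _ (IsModelAt.mul_self (hF x hx) (hP.isModelAt hx))] at h1
  have := h1.diag_nonneg (i := 0)
  simp at this
  linarith

/-- The Christoffel map of the Levi-Civita connection. -/
noncomputable def christoffel (P A B : MatField) : MatField := fun x =>
  (2 * (1 - (P x * P x).trace / 2)⁻¹) • (A x * P x * B x)

lemma chartMetric_eq (hS : S.IsRegular) (hF : IsFrameOn S g F)
    (hP : ∀ x ∈ S.dom, IsModelAt (g x) (P x) ∧ (P x * P x).trace < 2)
    (hA : ∀ x ∈ S.dom, IsModelAt (g x) (A x)) (hB : ∀ x ∈ S.dom, IsModelAt (g x) (B x)) :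
    chartMetric S g P A B =
      ∫ x in S.dom, 4 * ((1 - (P x * P x).trace / 2)⁻¹) ^ 2 * (A x * B x).trace := by
  have hD : ∀ X : MatField, (∀ x ∈ S.dom, IsModelAt (g x) (X x)) → ∀ x ∈ S.dom,
      cayleyChartDeriv g P X x = (2 / (1 - (P x * P x).trace / 2) ^ 2) •
        (g x * ((1 + P x) * X x * (1 + P x))) := by
    intro X hX x hx
    ext i j
    exact (IsModelAt.hasDerivAt_cayley (hF x hx) (hP x hx).1 (hX x hx) (hP x hx).2 i j).deriv
  refine setIntegral_congr_fun hS.measurableSet fun x hx => ?_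
  simp only [hD A hA x hx, hD B hB x hx]
  exact IsModelAt.trace_metric (hF x hx) (hP x hx).1 (hP x hx).2

lemma cayleyChartDeriv_zero (hF : IsFrameOn S g F) (hA : IsModelField S g A) {x : ℝ × ℝ}
    (hx : x ∈ S.dom) : cayleyChartDeriv g 0 A x = (2 : ℝ) • (g x * A x) := by
  ext i j
  have := (IsModelAt.hasDerivAt_cayley (hF x hx) IsModelAt.zero (hA.isModelAt hx) (by simp)
    i j).deriv
  refine this.trans ?_
  simp

/-- Only the conformal factor depends on `P`. The derivative of the integrand contains `tr(PC)
tr(AB)`, which the Clifford relation splits into the two Christoffel terms. -/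
lemma christoffel_compatible (hS : S.IsRegular) (hF : IsFrameOn S g F) (hP : InChartDomain S g P)
    (hA : IsModelField S g A) (hB : IsModelField S g B) (hC : IsModelField S g C)
    (h1 : IsModelField S g (christoffel P C A)) (h2 : IsModelField S g (christoffel P C B)) :
    HasDerivAt (fun t : ℝ => chartMetric S g (P + t • C) A B)
      (chartMetric S g P (christoffel P C A) B + chartMetric S g P A (christoffel P C B)) 0 := by
  obtain ⟨ε, hε, hle⟩ := hP.exists_trace_le hF
  have hfin := hS.isFiniteMeasure
  have hAB := hA.smoothBdd_trace_mul hS hF hB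
  obtain ⟨-, M, hM⟩ := hP.1.smoothBdd_trace_mul hS hF hC
  obtain ⟨-, N, hN⟩ := hC.smoothBdd_trace_mul hS hF hC
  obtain ⟨-, L, hL⟩ := hAB
  -- For `|t| < δ` the trace of `(P + tC)²` grows by at most `ε`, so `1 - tr/2` stays above `ε/2`.
  -- The bound `δ ≤ 1` gives `t² ≤ δ`, and the summand `1` keeps the denominator positive.
  set δ : ℝ := min 1 (ε / (2 * |M| + |N| + 1))
  have hden : 0 < 2 * |M| + |N| + 1 := by positivity
  have hδ0 : 0 < δ := lt_min one_pos (div_pos hε hden)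
  have hδ1 : δ ≤ 1 := min_le_left _ _
  have hδ2 : δ * (2 * |M| + |N| + 1) ≤ ε := (le_div_iff₀ hden).1 (min_le_right _ _)
  have hlow : ∀ t ∈ Metric.ball (0 : ℝ) δ, ∀ x ∈ S.dom,
      ε / 2 ≤ 1 - ((P x + t • C x) * (P x + t • C x)).trace / 2 := by
    intro t ht x hx
    rw [Metric.mem_ball, dist_zero_right, Real.norm_eq_abs] at ht
    rw [IsModelAt.trace_add_smul_mul_self]
    have b1 : t * (2 * (P x * C x).trace) ≤ δ * (2 * |M|) := by
      refine (le_abs_self _).trans ?_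
      rw [abs_mul, abs_mul, abs_two]
      have h := (hM x hx).trans (le_abs_self _)
      exact mul_le_mul ht.le (by linarith) (by positivity) hδ0.le
    have b2 : t ^ 2 * (C x * C x).trace ≤ δ * |N| := by
      refine (le_abs_self _).trans ?_
      rw [abs_mul, abs_pow]
      refine mul_le_mul ?_ ((hN x hx).trans (le_abs_self _)) (abs_nonneg _) hδ0.le
      nlinarith [abs_nonneg t]
    have := hle x hx
    nlinarith
  have hmodel : ∀ t ∈ Metric.ball (0 : ℝ) δ, ∀ x ∈ S.dom, IsModelAt (g x) ((P + t • C) x) ∧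
      ((P + t • C) x * (P + t • C) x).trace < 2 := fun t ht x hx =>
    ⟨(hP.1.isModelAt hx).add ((hC.isModelAt hx).smul t), by
      have := hlow t ht x hx
      show ((P x + t • C x) * (P x + t • C x)).trace < 2
      linarith⟩
  have hsm : ∀ t : ℝ, S.Smooth fun x => 1 - ((P x + t • C x) * (P x + t • C x)).trace / 2 := by
    intro t
    have h := hP.1.1.add hS (hC.1.const_smul hS t)
    have := hS.add (hS.const 1) (hS.mul (hS.const (-1 / 2)) ((h.mul hS h).trace hS))
    convert this using 2
    simp only [Pi.add_apply, Pi.smul_apply]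
    ring
  have hinv : ∀ t ∈ Metric.ball (0 : ℝ) δ, S.SmoothBdd fun x =>
      (1 - ((P x + t • C x) * (P x + t • C x)).trace / 2)⁻¹ := fun t ht =>
    hS.smoothBdd_inv (hsm t) (half_pos hε) (hlow t ht)
  have hAB := hA.smoothBdd_trace_mul hS hF hB
  have h0 : (0 : ℝ) ∈ Metric.ball (0 : ℝ) δ := Metric.mem_ball_self hδ0
  have hball : Metric.ball (0 : ℝ) δ ∈ nhds (0 : ℝ) := Metric.ball_mem_nhds _ hδ0
  have hG : ∀ t ∈ Metric.ball (0 : ℝ) δ, S.SmoothBdd fun x =>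
      4 * ((1 - ((P x + t • C x) * (P x + t • C x)).trace / 2)⁻¹) ^ 2 * (A x * B x).trace :=
    fun t ht => (((hinv t ht).pow hS 2).const_mul hS 4).mul hS hAB
  -- The `t`-derivative of the integrand `4 q⁻² tr(AB)`, where `q' = -(tr(PC) + t tr C²)`.
  let G' : ℝ → ℝ × ℝ → ℝ := fun t x =>
    8 * ((1 - ((P x + t • C x) * (P x + t • C x)).trace / 2)⁻¹) ^ 3 *
      ((P x * C x).trace + t * (C x * C x).trace) * (A x * B x).trace
  have hG'0 : S.SmoothBdd (G' 0) := by
    have := (((((hinv 0 h0).pow hS 3).const_mul hS 8).mul hS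
      (hP.1.smoothBdd_trace_mul hS hF hC)).mul hS hAB)
    simpa [G'] using this
  have hder : ∀ x ∈ S.dom, ∀ t ∈ Metric.ball (0 : ℝ) δ, HasDerivAt (fun t : ℝ =>
      4 * ((1 - ((P x + t • C x) * (P x + t • C x)).trace / 2)⁻¹) ^ 2 * (A x * B x).trace)
      (G' t x) t := by
    intro x hx t ht
    have hne : 1 - ((P x + t • C x) * (P x + t • C x)).trace / 2 ≠ 0 :=
      ((half_pos hε).trans_le (hlow t ht x hx)).ne'
    have h := ((((((IsModelAt.hasDerivAt_trace (P x) (C x) t).div_const 2).const_sub 1).inv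
      hne).pow 2).const_mul 4).mul_const (A x * B x).trace
    refine h.congr_deriv ?_
    simp only [G', Pi.inv_apply, Nat.add_one_sub_one, pow_one]
    generalize 1 - ((P x + t • C x) * (P x + t • C x)).trace / 2 = q at hne ⊢
    field_simp
    ring
  have hbound : ∀ x ∈ S.dom, ∀ t ∈ Metric.ball (0 : ℝ) δ,
      ‖G' t x‖ ≤ 8 * ((ε / 2)⁻¹) ^ 3 * (|M| + |N|) * L := by
    intro x hx t ht
    have hpos := (half_pos hε).trans_le (hlow t ht x hx)
    have ht' : |t| ≤ 1 := by
      rw [Metric.mem_ball, dist_zero_right, Real.norm_eq_abs] at ht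
      exact (ht.trans_le hδ1).le
    simp only [G', Real.norm_eq_abs, abs_mul, abs_pow, abs_inv, abs_of_pos hpos]
    rw [abs_of_pos (by norm_num : (0 : ℝ) < 8)]
    have c1 : |(P x * C x).trace + t * (C x * C x).trace| ≤ |M| + |N| := by
      refine (abs_add_le _ _).trans (add_le_add ((hM x hx).trans (le_abs_self _)) ?_)
      rw [abs_mul]
      calc |t| * |(C x * C x).trace| ≤ 1 * |(C x * C x).trace| := by gcongr
        _ ≤ |N| := by rw [one_mul]; exact (hN x hx).trans (le_abs_self _)
    have c2 := hlow t ht x hx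
    have c3 := hL x hx
    gcongr
  have key := (hasDerivAt_integral_of_dominated_loc_of_deriv_le (μ := volume.restrict S.dom)
    (F := fun (t : ℝ) (x : ℝ × ℝ) =>
      4 * ((1 - ((P x + t • C x) * (P x + t • C x)).trace / 2)⁻¹) ^ 2 * (A x * B x).trace)
    (F' := G') (x₀ := (0 : ℝ)) (s := Metric.ball (0 : ℝ) δ)
    (bound := fun _ => 8 * ((ε / 2)⁻¹) ^ 3 * (|M| + |N|) * L) hball
    (by filter_upwards [hball] with t ht using hS.aestronglyMeasurable (hG t ht).1)
    ((hG 0 h0).integrableOn hS) (hS.aestronglyMeasurable hG'0.1)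
    (by filter_upwards [ae_restrict_mem hS.measurableSet] with x hx using hbound x hx)
    (integrable_const _)
    (by filter_upwards [ae_restrict_mem hS.measurableSet] with x hx using hder x hx)).2
  refine (key.congr_of_eventuallyEq ?_).congr_deriv ?_
  · filter_upwards [hball] with t ht
    exact chartMetric_eq hS hF (hmodel t ht) (fun x hx => hA.isModelAt hx)
      (fun x hx => hB.isModelAt hx)
  · have hm0 : ∀ x ∈ S.dom, IsModelAt (g x) (P x) ∧ (P x * P x).trace < 2 := fun x hx =>
      ⟨hP.1.isModelAt hx, by linarith [hle x hx]⟩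
    have hi : S.SmoothBdd fun x => 4 * ((1 - (P x * P x).trace / 2)⁻¹) ^ 2 := by
      have := ((hinv 0 h0).pow hS 2).const_mul hS 4
      simpa using this
    rw [chartMetric_eq hS hF hm0 (fun x hx => h1.isModelAt hx) (fun x hx => hB.isModelAt hx),
      chartMetric_eq hS hF hm0 (fun x hx => hA.isModelAt hx) (fun x hx => h2.isModelAt hx),
      ← integral_add ((hi.mul hS (h1.smoothBdd_trace_mul hS hF hB)).integrableOn hS)
        ((hi.mul hS (hA.smoothBdd_trace_mul hS hF h2)).integrableOn hS)]
    refine setIntegral_congr_fun hS.measurableSet fun x hx => ?_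
    -- By cyclicity the left side is `tr(CP(AB + BA))`, and `AB + BA` is scalar.
    have e1 : (C x * P x * A x * B x).trace + (A x * (C x * P x * B x)).trace =
        (P x * C x).trace * (A x * B x).trace := by
      have hc := hF x hx
      rw [Matrix.trace_mul_comm (A x), Matrix.mul_assoc _ (A x), Matrix.mul_assoc _ (B x),
        ← Matrix.trace_add, ← Matrix.mul_add,
        IsModelAt.mul_add_mul hc (hA.isModelAt hx) (hB.isModelAt hx), Matrix.mul_smul,
        Matrix.trace_smul, Matrix.mul_one, smul_eq_mul, Matrix.trace_mul_comm (C x)]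
      ring
    simp only [G', christoffel, zero_smul, add_zero, zero_mul, Matrix.smul_mul, Matrix.mul_smul,
      Matrix.trace_smul, smul_eq_mul]
    rw [mul_assoc (8 * _), ← e1]
    ring

lemma isModelField_christoffel (hS : S.IsRegular) (hF : IsFrameOn S g F)
    (hP : InChartDomain S g P) (hA : IsModelField S g A) (hB : IsModelField S g B) :
    IsModelField S g (christoffel P A B) := by
  obtain ⟨ε, hε, hle⟩ := hP.exists_trace_le hF
  have hq : S.SmoothBdd fun x => (1 - (P x * P x).trace / 2)⁻¹ := by
    refine hS.smoothBdd_inv ?_ hε hle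
    have := hS.add (hS.const 1) (hS.mul (hS.const (-1 / 2)) ((hP.1.1.mul hS hP.1.1).trace hS))
    convert this using 2
    ring
  refine ⟨SmoothField.smul hS (hS.mul (hS.const 2) hq.1) ((hA.1.mul hS hP.1.1).mul hS hB.1),
    fun x hx => (IsModelAt.mul_mul (hF x hx) (hA.isModelAt hx) (hP.1.isModelAt hx)
      (hB.isModelAt hx)).smul _, ?_⟩
  -- Boundedness follows from `4 tr((APB)²) = tr A² tr P² tr B²` and the uniform bound on the
  -- conformal factor.
  obtain ⟨-, K, hK⟩ := (((hq.pow hS 2).mul hS (hA.smoothBdd_trace_mul hS hF hA)).mul hS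
    (hP.1.smoothBdd_trace_mul hS hF hP.1)).mul hS (hB.smoothBdd_trace_mul hS hF hB)
  refine ⟨K, fun x hx => (le_of_eq ?_).trans ((le_abs_self _).trans (hK x hx))⟩
  have := IsModelAt.trace_mul_mul_sq (hF x hx) (hA.isModelAt hx) (hP.1.isModelAt hx)
    (hB.isModelAt hx)
  simp only [christoffel, Matrix.smul_mul, Matrix.mul_smul, Matrix.trace_smul, smul_eq_mul]
  linear_combination ((1 - (P x * P x).trace / 2)⁻¹) ^ 2 * this

lemma isLeviCivita_christoffel (hS : S.IsRegular) (hF : IsFrameOn S g F) :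
    IsLeviCivita S g christoffel where
  mem _ _ _ hP hA hB := isModelField_christoffel hS hF hP hA hB
  torsionFree P A B hP hA hB x hx := by
    rw [christoffel, christoffel, IsModelAt.mul_mul_comm (hF x hx) (hA.isModelAt hx)
      (hP.1.isModelAt hx) (hB.isModelAt hx)]
  compatible P A B C hP hA hB hC := christoffel_compatible hS hF hP hA hB hC
    (isModelField_christoffel hS hF hP hC hA) (isModelField_christoffel hS hF hP hC hB)

end Fields

/-! ### Curvature at the centre of the parametrization, expressed by `α` and `β`. -/

section Curvature

variable {S : CoordSurface} {g F A B : MatField} {α β : ℝ × ℝ → ℂ}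

/-- The triple product vanishes at `t = 0`, so only the value `2` of the scalar prefactor there
contributes, not its derivative. -/
lemma hasDerivAt_christoffel (X A Y : Matrix (Fin 2) (Fin 2) ℝ) (i j : Fin 2) :
    HasDerivAt (fun t : ℝ => ((2 * (1 - ((t • A) * (t • A)).trace / 2)⁻¹) • (X * (t • A) * Y) :
      Matrix (Fin 2) (Fin 2) ℝ) i j) (((2 : ℝ) • (X * A * Y)) i j) 0 := by
  have hd := IsModelAt.hasDerivAt_trace 0 A 0
  simp only [zero_add] at hd
  have h := ((((hd.div_const 2).const_sub 1).inv (by simp)).const_mul 2).mul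
    ((hasDerivAt_id (0 : ℝ)).mul_const ((X * A * Y) i j))
  refine (h.congr_of_eventuallyEq (Filter.Eventually.of_forall fun t => ?_)).congr_deriv ?_
  · simp
  · simp

/-- Because of this the quadratic terms of the curvature disappear at the centre. -/
lemma christoffel_zero (A B : MatField) : christoffel 0 A B = 0 := by
  ext x i j
  simp [christoffel]

lemma hasCurvature_christoffel (A B : MatField) :
    HasCurvature S christoffel A B B
      (fun x => (2 : ℝ) • (B x * A x * B x) - (2 : ℝ) • (A x * B x * B x)) := by
  refine ⟨fun x => (2 : ℝ) • (B x * A x * B x), fun x => (2 : ℝ) • (A x * B x * B x),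
    fun x _ i j => hasDerivAt_christoffel _ _ _ i j, fun x _ i j => hasDerivAt_christoffel _ _ _ i j,
    ?_⟩
  simp only [christoffel_zero, add_zero]
  rfl

/-- The field of endomorphisms of the model space that corresponds to `formOf F α`. -/
noncomputable def modelOf (F : MatField) (α : ℝ × ℝ → ℂ) : MatField := fun x =>
  F x * tracelessSymm (α x).re (-(α x).im) * (F x).adjugate

/-- Complex functions with smooth and bounded real and imaginary part. -/
def ComplexSmoothBdd (S : CoordSurface) (α : ℝ × ℝ → ℂ) : Prop :=
  S.SmoothBdd (fun x => (α x).re) ∧ S.SmoothBdd fun x => (α x).im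

/-- The adjugate is polynomial in the entries, hence smooth without any knowledge of `det F` off the
domain; on the domain it serves as the inverse. -/
lemma IsFrameAt.adjugate_eq {g f : Matrix (Fin 2) (Fin 2) ℝ} (h : IsFrameAt g f) :
    f.adjugate = f⁻¹ := by
  rw [Matrix.inv_def, h.det_eq]
  simp

lemma modelOf_apply (hF : IsFrameOn S g F) {x : ℝ × ℝ} (hx : x ∈ S.dom) :
    modelOf F α x = F x * tracelessSymm (α x).re (-(α x).im) * (F x)⁻¹ := by
  rw [modelOf, (hF x hx).adjugate_eq]

lemma trace_modelOf_mul (hF : IsFrameOn S g F) {x : ℝ × ℝ} (hx : x ∈ S.dom) :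
    (modelOf F α x * modelOf F β x).trace =
      2 * ((α x).re * (β x).re + (α x).im * (β x).im) := by
  rw [modelOf_apply hF hx, modelOf_apply hF hx, (hF x hx).conj_mul, (hF x hx).trace_conj,
    trace_tracelessSymm_mul]
  ring

lemma isModelField_modelOf (hS : S.IsRegular) (hF : IsFrameOn S g F) (hs : SmoothField S F)
    (hα : ComplexSmoothBdd S α) : IsModelField S g (modelOf F α) := by
  refine ⟨?_, fun x hx => ?_, ?_⟩
  · have hneg : ∀ {f : ℝ × ℝ → ℝ}, S.Smooth f → S.Smooth fun x => -f x := fun hf => by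
      simpa using hS.mul (hS.const (-1)) hf
    refine (hs.mul hS ?_).mul hS ?_
    · intro i j
      fin_cases i <;> fin_cases j <;> simp only [tracelessSymm]
      exacts [hα.1.1, hneg hα.2.1, hneg hα.2.1, hneg hα.1.1]
    · intro i j
      simp only [Matrix.adjugate_fin_two]
      fin_cases i <;> fin_cases j
      exacts [hs 1 1, hneg (hs 0 1), hneg (hs 1 0), hs 0 0]
  · rw [modelOf_apply hF hx]
    exact (hF x hx).isModelAt_conj _ _
  · obtain ⟨-, C, hC⟩ := ((hα.1.pow hS 2).add hS (hα.2.pow hS 2)).const_mul hS 2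
    refine ⟨C, fun x hx => (le_of_eq ?_).trans ((le_abs_self _).trans (hC x hx))⟩
    rw [trace_modelOf_mul hF hx]
    ring

/-- The differential at the centre is `A ↦ 2gA`, and `2 Re(α dw²)` has the matrix `2 (Re α, -Im α;
-Im α, -Re α)` in the frame. This accounts for the factor and the sign in `modelOf`. -/
lemma cayleyChartDeriv_modelOf (hS : S.IsRegular) (hF : IsFrameOn S g F) (hs : SmoothField S F)
    (hα : ComplexSmoothBdd S α) {x : ℝ × ℝ} (hx : x ∈ S.dom) :
    cayleyChartDeriv g 0 (modelOf F α) x = formOf F α x := by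
  rw [cayleyChartDeriv_zero hF (isModelField_modelOf hS hF hs hα) hx, modelOf_apply hF hx,
    ← Matrix.mul_assoc, ← Matrix.mul_assoc, (hF x hx).mul_eq]
  ext i j
  simp only [formOf, tracelessSymm, Matrix.smul_apply, Matrix.mul_apply, Fin.sum_univ_two,
    Matrix.transpose_apply, Matrix.of_apply, Matrix.cons_val_zero, Matrix.cons_val_one,
    Matrix.cons_val', Matrix.empty_val', Matrix.cons_val_fin_one, smul_eq_mul]
  simp
  ring

lemma weakInner_formOf (hS : S.IsRegular) (hF : IsFrameOn S g F) (hs : SmoothField S F)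
    (hα : ComplexSmoothBdd S α) (hβ : ComplexSmoothBdd S β) :
    weakInner S g (formOf F α) (formOf F β) =
      8 * ∫ x in S.dom, ((α x).re * (β x).re + (α x).im * (β x).im) := by
  rw [weakInner, ← integral_const_mul]
  refine setIntegral_congr_fun hS.measurableSet fun x hx => ?_
  have hu := (hF x hx).isUnit_det_metric
  rw [← cayleyChartDeriv_modelOf hS hF hs hα hx, ← cayleyChartDeriv_modelOf hS hF hs hβ hx,
    cayleyChartDeriv_zero hF (isModelField_modelOf hS hF hs hα) hx,
    cayleyChartDeriv_zero hF (isModelField_modelOf hS hF hs hβ) hx]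
  simp only [Matrix.mul_smul, Matrix.smul_mul, Matrix.mul_assoc,
    Matrix.nonsing_inv_mul_cancel_left _ _ hu, Matrix.trace_smul, trace_modelOf_mul hF hx,
    smul_eq_mul]
  ring

/-- Pointwise `tr(BABA) - tr(ABBA)` is `-4` times the squared area `(Im αβ̄)²` of the parallelogram
spanned by `α` and `β`; the metric contributes a factor `4` and the curvature tensor a factor `2`.
-/
lemma chartMetric_curvature (hS : S.IsRegular) (hF : IsFrameOn S g F) (hs : SmoothField S F)
    (hα : ComplexSmoothBdd S α) (hβ : ComplexSmoothBdd S β) :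
    chartMetric S g 0 (fun x => (2 : ℝ) • (modelOf F β x * modelOf F α x * modelOf F β x) -
        (2 : ℝ) • (modelOf F α x * modelOf F β x * modelOf F β x)) (modelOf F α) =
      -(32 * ∫ x in S.dom, ((α x).im * (β x).re - (α x).re * (β x).im) ^ 2) := by
  have hA := isModelField_modelOf hS hF hs hα
  have hB := isModelField_modelOf hS hF hs hβ
  rw [chartMetric_eq (P := 0) hS hF (fun x _ => ⟨IsModelAt.zero, by simp⟩) (fun x hx => ?_)
    (fun x hx => hA.isModelAt hx), ← neg_mul, ← integral_const_mul]
  · refine setIntegral_congr_fun hS.measurableSet fun x hx => ?_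
    simp only [modelOf_apply hF hx, (hF x hx).conj_mul, tracelessSymm_mul_mul, Matrix.sub_mul,
      Matrix.smul_mul, Matrix.trace_sub, Matrix.trace_smul, (hF x hx).trace_conj,
      trace_tracelessSymm_mul]
    simp
    ring
  · have hc := hF x hx
    have h1 := (IsModelAt.mul_mul hc (hB.isModelAt hx) (hA.isModelAt hx) (hB.isModelAt hx)).smul 2
    have h2 :=
      (IsModelAt.mul_mul hc (hA.isModelAt hx) (hB.isModelAt hx) (hB.isModelAt hx)).smul (-2)
    simpa [sub_eq_add_neg] using h1.add h2

/-- The sectional curvature formula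
`K(a, b) = -½ ∫ (Im α β̄)² / (∫ |α|² ∫ |β|² - (∫ Re α β̄)²)`. -/
lemma hasSectionalCurvature_formOf (hS : S.IsRegular) (hg : IsAssociatedMetric S g)
    (hF : IsOrthonormalFrame S g F) (hα : ComplexSmoothBdd S α) (hβ : ComplexSmoothBdd S β)
    {a b c d κ : ℝ}
    (ha : ∫ x in S.dom, ((α x).re * (α x).re + (α x).im * (α x).im) = a)
    (hb : ∫ x in S.dom, ((β x).re * (β x).re + (β x).im * (β x).im) = b)
    (hc : ∫ x in S.dom, ((α x).re * (β x).re + (α x).im * (β x).im) = c)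
    (hd : ∫ x in S.dom, ((α x).im * (β x).re - (α x).re * (β x).im) ^ 2 = d)
    (hne : a * b - c ^ 2 ≠ 0) (hκ : κ = -(d / 2) / (a * b - c ^ 2)) :
    HasSectionalCurvature S g (formOf F α) (formOf F β) κ := by
  have hf := hF.isFrameOn hg
  refine ⟨modelOf F α, modelOf F β, isModelField_modelOf hS hf hF.1 hα,
    isModelField_modelOf hS hf hF.1 hβ,
    fun x hx => cayleyChartDeriv_modelOf hS hf hF.1 hα hx,
    fun x hx => cayleyChartDeriv_modelOf hS hf hF.1 hβ hx, ?_, christoffel, _,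
    isLeviCivita_christoffel hS hf, hasCurvature_christoffel _ _, ?_⟩
  · rw [weakInner_formOf hS hf hF.1 hα hα, weakInner_formOf hS hf hF.1 hβ hβ,
      weakInner_formOf hS hf hF.1 hα hβ, ha, hb, hc]
    contrapose! hne
    linarith
  · rw [weakInner_formOf hS hf hF.1 hα hα, weakInner_formOf hS hf hF.1 hβ hβ,
      weakInner_formOf hS hf hF.1 hα hβ, chartMetric_curvature hS hf hF.1 hα hβ, ha, hb, hc, hd, hκ,
      show 8 * a * (8 * b) - (8 * c) ^ 2 = 64 * (a * b - c ^ 2) by ring]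
    field_simp
    ring

/-- Needed because `aJ` and the form of `iα` are compared on the domain only. -/
lemma HasSectionalCurvature.congr_right (hS : S.IsRegular) {a b b' : MatField} {κ : ℝ}
    (h : HasSectionalCurvature S g a b κ) (hb : ∀ x ∈ S.dom, b x = b' x) :
    HasSectionalCurvature S g a b' κ := by
  obtain ⟨A, B, hA, hB, hAa, hBb, hne, Γ, R, hΓ, hR, hκ⟩ := h
  have h1 : weakInner S g a b = weakInner S g a b' :=
    setIntegral_congr_fun hS.measurableSet fun x hx => by simp only [hb x hx]
  have h2 : weakInner S g b b = weakInner S g b' b' :=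
    setIntegral_congr_fun hS.measurableSet fun x hx => by simp only [hb x hx]
  rw [h1, h2] at hne hκ
  exact ⟨A, B, hA, hB, hAa, fun x hx => (hBb x hx).trans (hb x hx), hne, Γ, R, hΓ, hR, hκ⟩

/-- The reason is `dw ∘ J = i dw`. -/
lemma compJ_formOf (hF : IsFrameOn S g F) {x : ℝ × ℝ} (hx : x ∈ S.dom) :
    formOf F (fun x => Complex.I * α x) x = compJ g (formOf F α) x := by
  have hc := hF x hx
  have e : acs g x = F x * !![0, -1; 1, 0] * (F x)⁻¹ := hc.acs_eq
  have form : ∀ γ : ℝ × ℝ → ℂ, formOf F γ x =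
      (2 : ℝ) • (((F x)⁻¹)ᵀ * tracelessSymm (γ x).re (-(γ x).im) * (F x)⁻¹) := by
    intro γ
    ext i j
    simp only [formOf, tracelessSymm, Matrix.smul_apply, Matrix.mul_apply, Fin.sum_univ_two,
      Matrix.transpose_apply, Matrix.of_apply, Matrix.cons_val_zero, Matrix.cons_val_one,
      Matrix.cons_val', Matrix.empty_val', Matrix.cons_val_fin_one, smul_eq_mul]
    simp
    ring
  rw [compJ, e, form, form]
  simp only [Matrix.smul_mul, Matrix.mul_assoc,
    Matrix.nonsing_inv_mul_cancel_left _ _ hc.isUnit_det]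
  rw [← Matrix.mul_assoc (tracelessSymm _ _) !![0, -1; 1, 0]]
  congr 3
  ext i j
  fin_cases i <;> fin_cases j <;> simp [tracelessSymm]

end Curvature

/-! ### Trigonometric integrals on the two domains. -/

section Fourier

/-- The phase `k s x₀ + l t x₁`. -/
def phase (s t : ℝ) (k l : ℤ) (x : ℝ × ℝ) : ℝ := k * s * x.1 + l * t * x.2

lemma phase_add (s t : ℝ) (k l m n : ℤ) (x : ℝ × ℝ) :
    phase s t (k + m) (l + n) x = phase s t k l x + phase s t m n x := by
  simp only [phase]
  push_cast
  ring

lemma phase_sub (s t : ℝ) (k l m n : ℤ) (x : ℝ × ℝ) :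
    phase s t (k - m) (l - n) x = phase s t k l x - phase s t m n x := by
  simp only [phase]
  push_cast
  ring

lemma phase_neg (s t : ℝ) (k l : ℤ) (x : ℝ × ℝ) :
    phase s t (-k) (-l) x = -phase s t k l x := by
  simp only [phase]
  push_cast
  ring

lemma phase_zero (s t : ℝ) (x : ℝ × ℝ) : phase s t 0 0 x = 0 := by simp [phase]

/-- The functions `cos (m s x)`, `sin (m s x)` have integral zero over the set `X` of measure `L`. -/
structure IsPeriodSet (X : Set ℝ) (s L : ℝ) : Prop where
  integral_one : ∫ _ in X, (1 : ℝ) = L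
  integral_cos : ∀ m : ℤ, m ≠ 0 → ∫ x in X, Real.cos (m * s * x) = 0
  integral_sin : ∀ m : ℤ, ∫ x in X, Real.sin (m * s * x) = 0

lemma isPeriodSet_Ioo (a b s : ℝ) (hab : a ≤ b) (hs : s ≠ 0)
    (hc : ∀ m : ℤ, Real.cos (m * s * b) = Real.cos (m * s * a))
    (hsin : ∀ m : ℤ, Real.sin (m * s * b) = Real.sin (m * s * a)) :
    IsPeriodSet (Set.Ioo a b) s (b - a) where
  integral_one := by simp [hab]
  integral_cos m hm := by
    rw [← integral_Ioc_eq_integral_Ioo, ← intervalIntegral.integral_of_le hab,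
      intervalIntegral.integral_comp_mul_left (fun x => Real.cos x)
        (mul_ne_zero (Int.cast_ne_zero.2 hm) hs), integral_cos, hsin, sub_self, smul_zero]
  integral_sin m := by
    rcases eq_or_ne m 0 with rfl | hm
    · simp
    rw [← integral_Ioc_eq_integral_Ioo, ← intervalIntegral.integral_of_le hab,
      intervalIntegral.integral_comp_mul_left (fun x => Real.sin x)
        (mul_ne_zero (Int.cast_ne_zero.2 hm) hs), integral_sin, hc, sub_self, smul_zero]

lemma isPeriodSet_two_pi : IsPeriodSet (Set.Ioo 0 (2 * Real.pi)) 1 (2 * Real.pi) := by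
  have := isPeriodSet_Ioo 0 (2 * Real.pi) 1 Real.two_pi_pos.le one_ne_zero
    (fun m => by simp)
    (fun m => by
      have := Real.sin_add_int_mul_two_pi 0 m
      simp only [zero_add] at this
      simp [this])
  simpa using this

lemma isPeriodSet_Ico_two_pi : IsPeriodSet (Set.Ico 0 (2 * Real.pi)) 1 (2 * Real.pi) := by
  have h := isPeriodSet_two_pi
  constructor
  · rw [integral_Ico_eq_integral_Ioo, h.integral_one]
  · intro m hm
    rw [integral_Ico_eq_integral_Ioo, h.integral_cos m hm]
  · intro m
    rw [integral_Ico_eq_integral_Ioo, h.integral_sin m]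

lemma isPeriodSet_neg_one_one : IsPeriodSet (Set.Ioo (-1) 1) Real.pi 2 := by
  have := isPeriodSet_Ioo (-1) 1 Real.pi (by norm_num) Real.pi_ne_zero
    (fun m => by simp) (fun m => by simp [Real.sin_int_mul_pi])
  norm_num at this
  exact this

/-- The trigonometric functions of the phases are smooth and have integral zero (except for the
constant one), and the domain has area `V`. -/
structure IsFourierDomain (S : CoordSurface) (s t V : ℝ) : Prop where
  regular : S.IsRegular
  pos : 0 < V
  smooth_cos : ∀ k l, S.Smooth fun x => Real.cos (phase s t k l x)
  smooth_sin : ∀ k l, S.Smooth fun x => Real.sin (phase s t k l x)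
  integral_one : ∫ _ in S.dom, (1 : ℝ) = V
  integral_cos : ∀ k l, (k, l) ≠ ((0, 0) : ℤ × ℤ) → ∫ x in S.dom, Real.cos (phase s t k l x) = 0
  integral_sin : ∀ k l, ∫ x in S.dom, Real.sin (phase s t k l x) = 0

/-- Addition formulas split the phase and Fubini factors the integrals. Every term with a sine
vanishes, and the product of cosines vanishes in a coordinate with nonzero frequency. -/
lemma isFourierDomain_prod {S : CoordSurface} {s t K L : ℝ} {X Y : Set ℝ} (hS : S.IsRegular)
    (hdom : S.dom = X ×ˢ Y) (hK : 0 < K) (hL : 0 < L) (hX : IsPeriodSet X s K)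
    (hY : IsPeriodSet Y t L)
    (hcos : ∀ k l, S.Smooth fun x => Real.cos (phase s t k l x))
    (hsin : ∀ k l, S.Smooth fun x => Real.sin (phase s t k l x)) :
    IsFourierDomain S s t (K * L) := by
  have hfin := hS.isFiniteMeasure
  have hint : ∀ f h : ℝ → ℝ, Continuous f → Continuous h → (∀ x, |f x| ≤ 1) → (∀ x, |h x| ≤ 1) →
      IntegrableOn (fun x : ℝ × ℝ => f x.1 * h x.2) S.dom := by
    intro f h hf hh hf1 hh1
    refine Integrable.of_bound (by fun_prop) 1 (Filter.Eventually.of_forall fun x => ?_)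
    rw [Real.norm_eq_abs, abs_mul]
    exact mul_le_one₀ (hf1 _) (abs_nonneg _) (hh1 _)
  have hprod : ∀ f h : ℝ → ℝ, ∫ x in S.dom, f x.1 * h x.2 =
      (∫ x in X, f x) * ∫ y in Y, h y := by
    intro f h
    rw [hdom, Measure.volume_eq_prod, setIntegral_prod_mul]
  have hcb : ∀ (c : ℝ), Continuous (fun x => Real.cos (c * x)) ∧ ∀ x, |Real.cos (c * x)| ≤ 1 :=
    fun c => ⟨by fun_prop, fun x => Real.abs_cos_le_one _⟩
  have hsb : ∀ (c : ℝ), Continuous (fun x => Real.sin (c * x)) ∧ ∀ x, |Real.sin (c * x)| ≤ 1 :=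
    fun c => ⟨by fun_prop, fun x => Real.abs_sin_le_one _⟩
  refine ⟨hS, mul_pos hK hL, hcos, hsin, ?_, ?_, ?_⟩
  · have := hprod (fun _ => 1) fun _ => 1
    rw [hX.integral_one, hY.integral_one] at this
    simpa using this
  · intro k l hkl
    simp only [phase, Real.cos_add]
    rw [integral_sub (hint (fun x => Real.cos (k * s * x)) (fun x => Real.cos (l * t * x))
        (hcb _).1 (hcb _).1 (hcb _).2 (hcb _).2)
      (hint (fun x => Real.sin (k * s * x)) (fun x => Real.sin (l * t * x))
        (hsb _).1 (hsb _).1 (hsb _).2 (hsb _).2),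
      hprod (fun x => Real.cos (k * s * x)) (fun x => Real.cos (l * t * x)),
      hprod (fun x => Real.sin (k * s * x)) (fun x => Real.sin (l * t * x)), hX.integral_sin,
      zero_mul, sub_zero, mul_eq_zero]
    by_cases hk : k = 0
    · exact Or.inr (hY.integral_cos l fun hl => hkl (by rw [hk, hl]))
    · exact Or.inl (hX.integral_cos k hk)
  · intro k l
    simp only [phase, Real.sin_add]
    rw [integral_add (hint (fun x => Real.sin (k * s * x)) (fun x => Real.cos (l * t * x))
        (hsb _).1 (hcb _).1 (hsb _).2 (hcb _).2)
      (hint (fun x => Real.cos (k * s * x)) (fun x => Real.sin (l * t * x))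
        (hcb _).1 (hsb _).1 (hcb _).2 (hsb _).2),
      hprod (fun x => Real.sin (k * s * x)) (fun x => Real.cos (l * t * x)),
      hprod (fun x => Real.cos (k * s * x)) (fun x => Real.sin (l * t * x)), hX.integral_sin,
      hY.integral_sin, zero_mul, mul_zero, add_zero]

lemma contDiff_phase (s t : ℝ) (k l : ℤ) : ContDiff ℝ ∞ (phase s t k l) := by
  unfold phase
  fun_prop

lemma isFourierDomain_torus : IsFourierDomain torus 1 1 (4 * Real.pi ^ 2) := by
  have h1 : ∀ k l x y, phase 1 1 k l (x + 2 * Real.pi, y) =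
      phase 1 1 k l (x, y) + k * (2 * Real.pi) := fun k l x y => by
    simp only [phase]
    ring
  have h2 : ∀ k l x y, phase 1 1 k l (x, y + 2 * Real.pi) =
      phase 1 1 k l (x, y) + l * (2 * Real.pi) := fun k l x y => by
    simp only [phase]
    ring
  have := isFourierDomain_prod isRegular_torus rfl Real.two_pi_pos Real.two_pi_pos
    isPeriodSet_Ico_two_pi isPeriodSet_Ico_two_pi
    (fun k l => ⟨Real.contDiff_cos.comp (contDiff_phase 1 1 k l), fun x y => by
        simp only [h1, Real.cos_add_int_mul_two_pi], fun x y => by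
        simp only [h2, Real.cos_add_int_mul_two_pi]⟩)
    (fun k l => ⟨Real.contDiff_sin.comp (contDiff_phase 1 1 k l), fun x y => by
        simp only [h1, Real.sin_add_int_mul_two_pi], fun x y => by
        simp only [h2, Real.sin_add_int_mul_two_pi]⟩)
  convert this using 1
  ring

/-- The interval for `z` has length `2`, so its frequencies are multiples of `π`; the area is `2π ·
2`. -/
lemma isFourierDomain_sphereChart :
    IsFourierDomain sphereChart 1 Real.pi (4 * Real.pi) := by
  have := isFourierDomain_prod isRegular_sphereChart rfl Real.two_pi_pos two_pos
    isPeriodSet_two_pi isPeriodSet_neg_one_one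
    (fun k l => (Real.contDiff_cos.comp (contDiff_phase 1 Real.pi k l)).contDiffOn)
    (fun k l => (Real.contDiff_sin.comp (contDiff_phase 1 Real.pi k l)).contDiffOn)
  convert this using 1
  ring

namespace IsFourierDomain

variable {S : CoordSurface} {s t V : ℝ} {k l m n : ℤ}

lemma smoothBdd_cos (hS : IsFourierDomain S s t V) (k l : ℤ) :
    S.SmoothBdd fun x => Real.cos (phase s t k l x) :=
  ⟨hS.smooth_cos k l, 1, fun _ _ => Real.abs_cos_le_one _⟩

lemma smoothBdd_sin (hS : IsFourierDomain S s t V) (k l : ℤ) :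
    S.SmoothBdd fun x => Real.sin (phase s t k l x) :=
  ⟨hS.smooth_sin k l, 1, fun _ _ => Real.abs_sin_le_one _⟩

lemma integral_const (hS : IsFourierDomain S s t V) (c : ℝ) : ∫ _ in S.dom, c = c * V := by
  rw [← hS.integral_one, ← integral_const_mul, mul_one]

lemma integrableOn_const (hS : IsFourierDomain S s t V) (c : ℝ) :
    IntegrableOn (fun _ : ℝ × ℝ => c) S.dom :=
  (hS.regular.smoothBdd_const c).integrableOn hS.regular

lemma integrableOn_cos (hS : IsFourierDomain S s t V) (c : ℝ) (k l : ℤ) :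
    IntegrableOn (fun x => c * Real.cos (phase s t k l x)) S.dom :=
  ((hS.smoothBdd_cos k l).const_mul hS.regular c).integrableOn hS.regular

lemma integrableOn_sin (hS : IsFourierDomain S s t V) (c : ℝ) (k l : ℤ) :
    IntegrableOn (fun x => c * Real.sin (phase s t k l x)) S.dom :=
  ((hS.smoothBdd_sin k l).const_mul hS.regular c).integrableOn hS.regular

lemma integral_const_mul_cos (hS : IsFourierDomain S s t V) (c : ℝ) (h : (k, l) ≠ (0, 0)) :
    ∫ x in S.dom, c * Real.cos (phase s t k l x) = 0 := by
  rw [integral_const_mul, hS.integral_cos k l h, mul_zero]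

lemma integral_const_mul_sin (hS : IsFourierDomain S s t V) (c : ℝ) (k l : ℤ) :
    ∫ x in S.dom, c * Real.sin (phase s t k l x) = 0 := by
  rw [integral_const_mul, hS.integral_sin k l, mul_zero]

lemma integrableOn_add_cos (hS : IsFourierDomain S s t V) {f : ℝ × ℝ → ℝ}
    (hf : IntegrableOn f S.dom) (c : ℝ) (k l : ℤ) :
    IntegrableOn (fun x => f x + c * Real.cos (phase s t k l x)) S.dom :=
  hf.add (hS.integrableOn_cos c k l)

lemma integral_add_cos (hS : IsFourierDomain S s t V) {f : ℝ × ℝ → ℝ}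
    (hf : IntegrableOn f S.dom) (c : ℝ) (h : (k, l) ≠ (0, 0)) :
    ∫ x in S.dom, (f x + c * Real.cos (phase s t k l x)) = ∫ x in S.dom, f x := by
  rw [integral_add hf (hS.integrableOn_cos c k l), hS.integral_const_mul_cos c h, add_zero]

/-- The integral of `(1 + ε cos 2θ) / 2`. -/
lemma integral_half_add (hS : IsFourierDomain S s t V) (ε : ℝ) (h : (k, l) ≠ (0, 0)) :
    ∫ x in S.dom, (1 + ε * Real.cos (2 * phase s t k l x)) / 2 = V / 2 := by
  have e : ∀ x, (1 + ε * Real.cos (2 * phase s t k l x)) / 2 =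
      1 / 2 + ε / 2 * Real.cos (phase s t (k + k) (l + l) x) := fun x => by
    rw [phase_add, two_mul]
    ring
  simp only [e]
  rw [integral_add (hS.integrableOn_const _) (hS.integrableOn_cos _ _ _), hS.integral_const,
    hS.integral_const_mul_cos]
  · ring
  · simp only [ne_eq, Prod.mk.injEq] at h ⊢
    omega

/-- The integral of `(1 + ε cos 2θ) / 2 * (1 + δ cos 2θ') / 2` for `θ ≠ ± θ'`. -/
lemma integral_half_add_mul (hS : IsFourierDomain S s t V) (ε δ : ℝ) (h : (k, l) ≠ (0, 0))
    (h' : (m, n) ≠ (0, 0)) (h1 : (k, l) ≠ (m, n)) (h2 : (k, l) ≠ (-m, -n)) :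
    ∫ x in S.dom, (1 + ε * Real.cos (2 * phase s t k l x)) / 2 *
      ((1 + δ * Real.cos (2 * phase s t m n x)) / 2) = V / 4 := by
  have e : ∀ x, (1 + ε * Real.cos (2 * phase s t k l x)) / 2 *
      ((1 + δ * Real.cos (2 * phase s t m n x)) / 2) =
      1 / 4 + ε / 4 * Real.cos (phase s t (k + k) (l + l) x) +
        δ / 4 * Real.cos (phase s t (m + m) (n + n) x) +
        ε * δ / 8 * Real.cos (phase s t (k + k + (m + m)) (l + l + (n + n)) x) +
        ε * δ / 8 * Real.cos (phase s t (k + k - (m + m)) (l + l - (n + n)) x) := fun x => by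
    simp only [phase_add, phase_sub, two_mul]
    rw [Real.cos_add (_ + _) (phase s t m n x + _), Real.cos_sub]
    ring
  simp only [e]
  have i1 := hS.integrableOn_const (1 / 4)
  have i2 := hS.integrableOn_add_cos i1 (ε / 4) (k + k) (l + l)
  have i3 := hS.integrableOn_add_cos i2 (δ / 4) (m + m) (n + n)
  have i4 := hS.integrableOn_add_cos i3 (ε * δ / 8) (k + k + (m + m)) (l + l + (n + n))
  -- The frequencies `2θ`, `2θ'` and `2(θ ± θ')` are nonzero by the four hypotheses, so only the
  -- constant `1/4` survives.
  rw [hS.integral_add_cos i4, hS.integral_add_cos i3, hS.integral_add_cos i2,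
    hS.integral_add_cos i1, hS.integral_const]
  · ring
  all_goals
    simp only [ne_eq, Prod.mk.injEq] at h h' h1 h2 ⊢
    omega

/-- The integral of `((1 + ε cos 2θ) / 2)²` for `ε = ± 1`. -/
lemma integral_half_add_sq (hS : IsFourierDomain S s t V) {ε : ℝ} (hε : ε ^ 2 = 1)
    (h : (k, l) ≠ (0, 0)) :
    ∫ x in S.dom, (1 + ε * Real.cos (2 * phase s t k l x)) / 2 *
      ((1 + ε * Real.cos (2 * phase s t k l x)) / 2) = 3 * V / 8 := by
  -- The constant `3/8` is `1/4` plus the mean `1/8` of `cos² 2θ / 4`.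
  have e : ∀ x, (1 + ε * Real.cos (2 * phase s t k l x)) / 2 *
      ((1 + ε * Real.cos (2 * phase s t k l x)) / 2) =
      3 / 8 + ε / 2 * Real.cos (phase s t (k + k) (l + l) x) +
        1 / 8 * Real.cos (phase s t (k + k + (k + k)) (l + l + (l + l)) x) := fun x => by
    simp only [phase_add]
    rw [← two_mul (phase s t k l x), ← two_mul (2 * _), Real.cos_two_mul (2 * _)]
    linear_combination Real.cos (2 * phase s t k l x) ^ 2 / 4 * hε
  simp only [e]
  have i1 := hS.integrableOn_const (3 / 8)
  have i2 := hS.integrableOn_add_cos i1 (ε / 2) (k + k) (l + l)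
  rw [hS.integral_add_cos i2, hS.integral_add_cos i1, hS.integral_const]
  · ring
  all_goals
    simp only [ne_eq, Prod.mk.injEq] at h ⊢
    omega

end IsFourierDomain

end Fourier

/-! ### Sectional curvatures for the trigonometric system. -/

section BasisFunctions

variable {S : CoordSurface} {s t V : ℝ} {p q : ℝ × ℝ → ℝ} {α β : ℝ × ℝ → ℂ} {g F : MatField}

/-- The squares `cos² θ = (1 + cos 2θ) / 2`, `sin² θ = (1 - cos 2θ) / 2` of the nonzero functions
`cos θ`, `sin θ`, `θ = k s x₀ + l t x₁`. -/
def IsTrigSquare (s t : ℝ) (p : ℝ × ℝ → ℝ) : Prop :=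
  ∃ (k l : ℤ) (ε : ℝ), ε ^ 2 = 1 ∧ ((k, l) = (0, 0) → ε = 1) ∧
    ∀ x, p x = (1 + ε * Real.cos (2 * phase s t k l x)) / 2

lemma IsTrigSquare.smoothBdd (hS : IsFourierDomain S s t V) (hp : IsTrigSquare s t p) :
    S.SmoothBdd p := by
  obtain ⟨k, l, ε, -, -, hp⟩ := hp
  have := ((hS.regular.smoothBdd_const (1 / 2)).add hS.regular
    ((hS.smoothBdd_cos (k + k) (l + l)).const_mul hS.regular (ε / 2)))
  convert this using 2 with x
  rw [hp, phase_add, two_mul]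
  ring

lemma IsTrigSquare.integral (hS : IsFourierDomain S s t V) (hp : IsTrigSquare s t p) :
    ((∀ x, p x = 1) ∧ ∫ x in S.dom, p x = V) ∨
      (¬ (∀ x, p x = 1) ∧ ∫ x in S.dom, p x = V / 2 ∧ ∫ x in S.dom, p x * p x = 3 * V / 8) := by
  obtain ⟨k, l, ε, hε, h0, hp⟩ := hp
  by_cases h : (k, l) = (0, 0)
  · have h1 : ∀ x, p x = 1 := fun x => by
      obtain ⟨rfl, rfl⟩ := Prod.mk.inj h
      rw [hp, h0 rfl, phase_zero]
      simp
    refine Or.inl ⟨h1, ?_⟩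
    simp only [h1, hS.integral_one]
  · have h2 : ∫ x in S.dom, p x = V / 2 := by
      simp only [hp, hS.integral_half_add ε h]
    refine Or.inr ⟨fun h1 => ?_, h2, by simp only [hp, hS.integral_half_add_sq hε h]⟩
    simp only [h1, hS.integral_one] at h2
    linarith [hS.pos]

lemma IsTrigSquare.integral_pos (hS : IsFourierDomain S s t V) (hp : IsTrigSquare s t p) :
    0 < ∫ x in S.dom, p x := by
  have := hS.pos
  rcases hp.integral hS with ⟨-, h⟩ | ⟨-, h, -⟩ <;> rw [h] <;> linarith

/-- A correlation could come only from phases that agree up to sign. Then the cosines coincide, and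
equal or opposite signs `ε`, `δ` give `p = q` or `p + q = 1`, both excluded. -/
lemma IsTrigSquare.integral_mul (hS : IsFourierDomain S s t V) (hp : IsTrigSquare s t p)
    (hq : IsTrigSquare s t q) (h1 : ¬ ∀ x, p x = q x) (h2 : ¬ ∀ x, p x + q x = 1) :
    ∫ x in S.dom, p x * q x = (∫ x in S.dom, p x) * (∫ x in S.dom, q x) / V := by
  have hV := hS.pos.ne'
  rcases hp.integral hS with ⟨hp1, hpi⟩ | ⟨hp1, hpi, -⟩
  · simp only [hp1, one_mul, hS.integral_one]
    field_simp
  rcases hq.integral hS with ⟨hq1, hqi⟩ | ⟨hq1, hqi, -⟩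
  · simp only [hq1, mul_one, hS.integral_one]
    field_simp
  obtain ⟨k, l, ε, hε, h0, hp⟩ := hp
  obtain ⟨m, n, δ, hδ, h0', hq⟩ := hq
  have nz : (k, l) ≠ (0, 0) := fun h => hp1 fun x => by
    obtain ⟨rfl, rfl⟩ := Prod.mk.inj h
    rw [hp, h0 rfl, phase_zero]
    simp
  have nz' : (m, n) ≠ (0, 0) := fun h => hq1 fun x => by
    obtain ⟨rfl, rfl⟩ := Prod.mk.inj h
    rw [hq, h0' rfl, phase_zero]
    simp
  have key : ¬ ∀ x, Real.cos (2 * phase s t k l x) = Real.cos (2 * phase s t m n x) := by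
    intro hcos
    rcases sq_eq_sq_iff_eq_or_eq_neg.1 (hε.trans hδ.symm) with e | e
    · exact h1 fun x => by rw [hp, hq, hcos, e]
    · refine h2 fun x => ?_
      rw [hp, hq, hcos, e]
      ring
  rw [hpi, hqi]
  simp only [hp, hq]
  rw [hS.integral_half_add_mul ε δ nz nz']
  · field_simp
    norm_num
  · intro h
    obtain ⟨rfl, rfl⟩ := Prod.mk.inj h
    exact key fun x => rfl
  · intro h
    obtain ⟨rfl, rfl⟩ := Prod.mk.inj h
    exact key fun x => by rw [phase_neg, mul_neg, Real.cos_neg]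

lemma IsRealBasisFun.exists_ofReal (hS : IsFourierDomain S s t V) (hα : IsRealBasisFun s t α)
    (h0 : α ≠ 0) : ∃ ρ : ℝ × ℝ → ℝ, (α = fun x => ((ρ x : ℝ) : ℂ)) ∧ S.SmoothBdd ρ ∧
      IsTrigSquare s t fun x => ρ x * ρ x := by
  obtain ⟨k, l, h | h⟩ := hα
  · refine ⟨_, h, hS.smoothBdd_cos k l, k, l, 1, by norm_num, fun _ => rfl, fun x => ?_⟩
    simp only [phase]
    rw [Real.cos_two_mul]
    ring
  -- Here `sin² θ` has `ε = -1`, so frequency zero must be ruled out: it would make the function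
  -- vanish.
  · refine ⟨_, h, hS.smoothBdd_sin k l, k, l, -1, by norm_num, fun e => ?_, fun x => ?_⟩
    · refine absurd (h.trans ?_) h0
      obtain ⟨rfl, rfl⟩ := Prod.mk.inj e
      ext x
      simp
    · simp only [phase]
      rw [Real.cos_two_mul, Real.cos_sq']
      ring

/-- Sectional curvature for orthogonal `α`, `β` in terms of `p = |α|²`, `q = |β|²`. -/
lemma hasSectionalCurvature_of_orthogonal (hS : IsFourierDomain S s t V)
    (hg : IsAssociatedMetric S g) (hF : IsOrthonormalFrame S g F) (hα : ComplexSmoothBdd S α)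
    (hβ : ComplexSmoothBdd S β) (hp : IsTrigSquare s t p) (hq : IsTrigSquare s t q)
    (hαp : ∀ x, (α x).re * (α x).re + (α x).im * (α x).im = p x)
    (hβq : ∀ x, (β x).re * (β x).re + (β x).im * (β x).im = q x)
    (hre : ∀ x, (α x).re * (β x).re + (α x).im * (β x).im = 0)
    (him : ∀ x, ((α x).im * (β x).re - (α x).re * (β x).im) ^ 2 = p x * q x) :
    ((¬ (∀ x, p x = q x) → ¬ (∀ x, p x + q x = 1) →
      HasSectionalCurvature S g (formOf F α) (formOf F β) (-1 / (2 * V))) ∧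
    ((∀ x, p x + q x = 1) →
      HasSectionalCurvature S g (formOf F α) (formOf F β) (-1 / (4 * V))) ∧
    ((∀ x, p x = q x) → ¬ (∀ x, p x = 1) →
      HasSectionalCurvature S g (formOf F α) (formOf F β) (-3 / (4 * V))) ∧
    ((∀ x, p x = 1) → (∀ x, q x = 1) →
      HasSectionalCurvature S g (formOf F α) (formOf F β) (-1 / (2 * V)))) := by
  have hV := hS.pos
  have hV' := hV.ne'
  have main : ∀ {a b d κ : ℝ}, ∫ x in S.dom, p x = a → ∫ x in S.dom, q x = b →
      ∫ x in S.dom, p x * q x = d → κ = -(d / 2) / (a * b) →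
      HasSectionalCurvature S g (formOf F α) (formOf F β) κ := by
    intro a b d κ ha hb hd hκ
    have ha' : a ≠ 0 := ha ▸ (hp.integral_pos hS).ne'
    have hb' : b ≠ 0 := hb ▸ (hq.integral_pos hS).ne'
    refine hasSectionalCurvature_formOf (c := 0) hS.regular hg hF hα hβ (by simpa only [hαp])
      (by simpa only [hβq]) (by simp only [hre, integral_zero]) (by simpa only [him]) ?_ ?_
    · simpa using ⟨ha', hb'⟩
    · rw [hκ]
      simp
  refine ⟨fun h1 h2 => ?_, fun h => ?_, fun h h1 => ?_, fun h1 h2 => ?_⟩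
  · refine main rfl rfl (hp.integral_mul hS hq h1 h2) ?_
    have ha := (hp.integral_pos hS).ne'
    have hb := (hq.integral_pos hS).ne'
    field_simp
  · have hq' : ∀ x, q x = 1 - p x := fun x => by linarith [h x]
    have hpb := hp.smoothBdd hS
    have h3 : ∫ x in S.dom, q x = V - ∫ x in S.dom, p x := by
      simp only [hq']
      rw [integral_sub (hS.integrableOn_const 1) (hpb.integrableOn hS.regular), hS.integral_one]
    rcases hp.integral hS with ⟨-, hpi⟩ | ⟨-, hpi, hpp⟩
    -- If `p` were identically `1`, its complement `q` would have integral zero.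
    · have := hq.integral_pos hS
      rw [h3, hpi] at this
      linarith
    · refine main hpi (h3.trans (by rw [hpi])) (d := V / 2 - 3 * V / 8) ?_ (by field_simp; norm_num)
      simp only [hq', mul_sub, mul_one]
      rw [integral_sub (hpb.integrableOn hS.regular)
        ((hpb.mul hS.regular hpb).integrableOn hS.regular), hpi, hpp]
  · obtain rfl : p = q := funext h
    rcases hp.integral hS with ⟨h2, -⟩ | ⟨-, hpi, hpp⟩
    · exact absurd h2 h1
    · exact main hpi hpi hpp (by field_simp; norm_num)
  · refine main (a := V) (b := V) (d := V) ?_ ?_ ?_ (by field_simp)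
    all_goals simp only [h1, h2, mul_one, hS.integral_one]

lemma complexSmoothBdd_ofReal (hS : S.IsRegular) {ρ : ℝ × ℝ → ℝ} (hρ : S.SmoothBdd ρ) :
    ComplexSmoothBdd S fun x => ((ρ x : ℝ) : ℂ) :=
  ⟨by simpa using hρ, by simpa using hS.smoothBdd_const 0⟩

lemma ComplexSmoothBdd.I_mul (hS : S.IsRegular) (hα : ComplexSmoothBdd S α) :
    ComplexSmoothBdd S fun x => Complex.I * α x :=
  ⟨by simpa using hα.2.const_mul hS (-1), by simpa using hα.1⟩

/-- A real and an imaginary function satisfy `Re αβ̄ = 0` and `(Im αβ̄)² = |α|²|β|²`, so the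
orthogonal case applies. -/
theorem sectionalCurvature_real_imag (hS : IsFourierDomain S s t V)
    (hg : IsAssociatedMetric S g) (hF : IsOrthonormalFrame S g F) (hα : IsRealBasisFun s t α)
    (hβ : IsImagBasisFun s t β) (hα0 : α ≠ 0) (hβ0 : β ≠ 0) :
    ((¬ (∀ x, ‖α x‖ = ‖β x‖) → ¬ (∀ x, ‖α x‖ ^ 2 + ‖β x‖ ^ 2 = 1) →
      HasSectionalCurvature S g (formOf F α) (formOf F β) (-1 / (2 * V))) ∧
    ((∀ x, ‖α x‖ ^ 2 + ‖β x‖ ^ 2 = 1) →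
      HasSectionalCurvature S g (formOf F α) (formOf F β) (-1 / (4 * V))) ∧
    ((∀ x, ‖α x‖ = ‖β x‖) → ¬ (∀ x, ‖α x‖ = 1) →
      HasSectionalCurvature S g (formOf F α) (formOf F β) (-3 / (4 * V))) ∧
    ((∀ x, ‖α x‖ = 1) → (∀ x, ‖β x‖ = 1) →
      HasSectionalCurvature S g (formOf F α) (formOf F β) (-1 / (2 * V)))) := by
  obtain ⟨ρ, rfl, hρ, hρ2⟩ := hα.exists_ofReal hS hα0
  obtain ⟨γ, hγ, rfl⟩ := hβ
  have hγ0 : γ ≠ 0 := by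
    rintro rfl
    exact hβ0 (by ext; simp)
  obtain ⟨σ, rfl, hσ, hσ2⟩ := hγ.exists_ofReal hS hγ0
  have key := hasSectionalCurvature_of_orthogonal hS hg hF (complexSmoothBdd_ofReal hS.regular hρ)
    ((complexSmoothBdd_ofReal hS.regular hσ).I_mul hS.regular) hρ2 hσ2 (by simp) (by simp)
    (by simp) (by intro x; simp; ring)
  have e1 : ∀ x, ‖((ρ x : ℝ) : ℂ)‖ = ‖Complex.I * ((σ x : ℝ) : ℂ)‖ ↔ ρ x * ρ x = σ x * σ x :=
    fun x => by simp [abs_eq_iff_mul_self_eq]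
  have e2 : ∀ x, ‖((ρ x : ℝ) : ℂ)‖ ^ 2 + ‖Complex.I * ((σ x : ℝ) : ℂ)‖ ^ 2 = 1 ↔
      ρ x * ρ x + σ x * σ x = 1 := fun x => by simp [pow_two]
  have e3 : ∀ x, ‖((ρ x : ℝ) : ℂ)‖ = 1 ↔ ρ x * ρ x = 1 :=
    fun x => by simpa using abs_eq_iff_mul_self_eq (a := ρ x) (b := 1)
  have e4 : ∀ x, ‖Complex.I * ((σ x : ℝ) : ℂ)‖ = 1 ↔ σ x * σ x = 1 :=
    fun x => by simpa using abs_eq_iff_mul_self_eq (a := σ x) (b := 1)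
  simpa only [e1, e2, e3, e4] using key

/-- Multiplication by `i` gives a pointwise orthogonal function of the same modulus, so only the
cases with `p = q` occur. -/
theorem sectionalCurvature_compJ (hS : IsFourierDomain S s t V)
    (hg : IsAssociatedMetric S g) (hF : IsOrthonormalFrame S g F)
    (hα : IsRealBasisFun s t α ∨ IsImagBasisFun s t α) (hα0 : α ≠ 0) :
    (¬ (∀ x, ‖α x‖ = 1) →
      HasSectionalCurvature S g (formOf F α) (compJ g (formOf F α)) (-3 / (4 * V))) ∧
    ((∀ x, ‖α x‖ = 1) →
      HasSectionalCurvature S g (formOf F α) (compJ g (formOf F α)) (-1 / (2 * V))) := by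
  obtain ⟨p, hp, hb, hαp⟩ : ∃ p, IsTrigSquare s t p ∧ ComplexSmoothBdd S α ∧
      ∀ x, (α x).re * (α x).re + (α x).im * (α x).im = p x := by
    rcases hα with hα | ⟨γ, hγ, rfl⟩
    · obtain ⟨ρ, rfl, hρ, hρ2⟩ := hα.exists_ofReal hS hα0
      exact ⟨_, hρ2, complexSmoothBdd_ofReal hS.regular hρ, by simp⟩
    · have hγ0 : γ ≠ 0 := by
        rintro rfl
        exact hα0 (by ext; simp)
      obtain ⟨σ, rfl, hσ, hσ2⟩ := hγ.exists_ofReal hS hγ0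
      exact ⟨_, hσ2, (complexSmoothBdd_ofReal hS.regular hσ).I_mul hS.regular, by simp⟩
  have e : ∀ x, ‖α x‖ = 1 ↔ p x = 1 := fun x => by
    rw [← hαp x, ← Complex.normSq_apply, Complex.normSq_eq_norm_sq,
      pow_eq_one_iff_of_nonneg (norm_nonneg _) two_ne_zero]
  obtain ⟨-, -, h3, h4⟩ := hasSectionalCurvature_of_orthogonal hS hg hF hb
    (hb.I_mul hS.regular) hp hp hαp (fun x => by rw [← hαp x]; simp; ring)
    (fun x => by simp; ring) (fun x => by rw [← hαp x]; simp; ring)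
  have hJ : ∀ x ∈ S.dom, formOf F (fun x => Complex.I * α x) x = compJ g (formOf F α) x :=
    fun x hx => compJ_formOf (hF.isFrameOn hg) hx
  exact ⟨fun h => (h3 (fun _ => rfl) (by simpa only [← e] using h)).congr_right hS.regular hJ,
    fun h => (h4 (fun x => (e x).1 (h x)) fun x => (e x).1 (h x)).congr_right hS.regular hJ⟩

/-- Reversing the phase fixes a cosine and negates a sine, so excluding `ρ = ±σ` excludes all
coincidences of frequencies up to sign. Mixed products expand into sines and always integrate to
zero. -/
lemma integral_mul_eq_zero (hS : IsFourierDomain S s t V) {ρ σ : ℝ × ℝ → ℝ}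
    (hρ : IsRealBasisFun s t fun x => ((ρ x : ℝ) : ℂ))
    (hσ : IsRealBasisFun s t fun x => ((σ x : ℝ) : ℂ))
    (h1 : ρ ≠ σ) (h2 : ρ ≠ -σ) : ∫ x in S.dom, ρ x * σ x = 0 := by
  have real : ∀ {ρ : ℝ × ℝ → ℝ}, (IsRealBasisFun s t fun x => ((ρ x : ℝ) : ℂ)) →
      ∃ k l, (ρ = fun x => Real.cos (phase s t k l x)) ∨
        (ρ = fun x => Real.sin (phase s t k l x)) := by
    rintro ρ ⟨k, l, h⟩
    refine ⟨k, l, h.imp (fun h => ?_) (fun h => ?_)⟩ <;> ext x <;>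
      exact Complex.ofReal_injective (congrFun h x)
  have cos_sin : ∀ k l m n : ℤ,
      ∫ x in S.dom, Real.cos (phase s t k l x) * Real.sin (phase s t m n x) = 0 := by
    intro k l m n
    have e : ∀ x, Real.cos (phase s t k l x) * Real.sin (phase s t m n x) =
        1 / 2 * Real.sin (phase s t (m + k) (n + l) x) +
          1 / 2 * Real.sin (phase s t (m - k) (n - l) x) := fun x => by
      rw [phase_add, phase_sub, Real.sin_add, Real.sin_sub]
      ring
    simp only [e]
    rw [integral_add (hS.integrableOn_sin _ _ _) (hS.integrableOn_sin _ _ _),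
      hS.integral_const_mul_sin, hS.integral_const_mul_sin, add_zero]
  have cos_cos : ∀ (c : ℝ) {k l m n : ℤ}, (k, l) ≠ (m, n) → (k, l) ≠ (-m, -n) →
      ∫ x in S.dom, (1 / 2 * Real.cos (phase s t (k - m) (l - n) x) +
        c * Real.cos (phase s t (k + m) (l + n) x)) = 0 := by
    intro c k l m n h h'
    rw [hS.integral_add_cos (hS.integrableOn_cos _ _ _), hS.integral_const_mul_cos]
    all_goals
      simp only [ne_eq, Prod.mk.injEq] at h h' ⊢
      omega
  obtain ⟨k, l, rfl | rfl⟩ := real hρ <;> obtain ⟨m, n, rfl | rfl⟩ := real hσ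
  · rw [← cos_cos (1 / 2) (k := k) (l := l) (m := m) (n := n)]
    · refine integral_congr_ae (Filter.Eventually.of_forall fun x => ?_)
      simp only [phase_add, phase_sub, Real.cos_add, Real.cos_sub]
      ring
    · intro h
      obtain ⟨rfl, rfl⟩ := Prod.mk.inj h
      exact h1 rfl
    · intro h
      obtain ⟨rfl, rfl⟩ := Prod.mk.inj h
      exact h1 (by simp only [phase_neg, Real.cos_neg])
  · exact cos_sin k l m n
  · simp only [mul_comm (Real.sin _)]
    exact cos_sin m n k l
  · rw [← cos_cos (-1 / 2) (k := k) (l := l) (m := m) (n := n)]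
    · refine integral_congr_ae (Filter.Eventually.of_forall fun x => ?_)
      simp only [phase_add, phase_sub, Real.cos_add, Real.cos_sub]
      ring
    · intro h
      obtain ⟨rfl, rfl⟩ := Prod.mk.inj h
      exact h1 rfl
    · intro h
      obtain ⟨rfl, rfl⟩ := Prod.mk.inj h
      exact h2 (by ext x; simp only [phase_neg, Real.sin_neg, Pi.neg_apply])

/-- The numerator vanishes since `αβ̄` is real. Independence excludes `α = ±β`, so the functions are
`L²`-orthogonal and the denominator is nonzero. -/
theorem sectionalCurvature_eq_zero (hS : IsFourierDomain S s t V)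
    (hg : IsAssociatedMetric S g) (hF : IsOrthonormalFrame S g F)
    (h : (IsRealBasisFun s t α ∧ IsRealBasisFun s t β) ∨
      (IsImagBasisFun s t α ∧ IsImagBasisFun s t β))
    (hli : LinearIndependent ℝ ![α, β]) :
    HasSectionalCurvature S g (formOf F α) (formOf F β) 0 := by
  have hα0 : α ≠ 0 := hli.ne_zero 0
  have hβ0 : β ≠ 0 := hli.ne_zero 1
  have hinj : α ≠ β := fun e => by
    have := LinearIndependent.pair_iff.1 hli 1 (-1) (by simp [e])
    norm_num at this
  have hinj' : α ≠ -β := fun e => by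
    have := LinearIndependent.pair_iff.1 hli 1 1 (by simp [e])
    norm_num at this
  rcases h with ⟨hα, hβ⟩ | ⟨⟨γ, hγ, rfl⟩, ⟨δ, hδ, rfl⟩⟩
  · obtain ⟨ρ, rfl, hρ, hρ2⟩ := hα.exists_ofReal hS hα0
    obtain ⟨σ, rfl, hσ, hσ2⟩ := hβ.exists_ofReal hS hβ0
    refine hasSectionalCurvature_formOf (c := 0) (d := 0) hS.regular hg hF
      (complexSmoothBdd_ofReal hS.regular hρ) (complexSmoothBdd_ofReal hS.regular hσ)
      rfl rfl ?_ (by simp) ?_ (by simp)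
    · simpa using integral_mul_eq_zero hS hα hβ (fun e => hinj (by rw [e]))
        (fun e => hinj' (by ext; simp [e]))
    · simpa using ⟨(hρ2.integral_pos hS).ne', (hσ2.integral_pos hS).ne'⟩
  · have hγ0 : γ ≠ 0 := by
      rintro rfl
      exact hα0 (by ext; simp)
    have hδ0 : δ ≠ 0 := by
      rintro rfl
      exact hβ0 (by ext; simp)
    obtain ⟨ρ, rfl, hρ, hρ2⟩ := hγ.exists_ofReal hS hγ0
    obtain ⟨σ, rfl, hσ, hσ2⟩ := hδ.exists_ofReal hS hδ0
    refine hasSectionalCurvature_formOf (c := 0) (d := 0) hS.regular hg hF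
      ((complexSmoothBdd_ofReal hS.regular hρ).I_mul hS.regular)
      ((complexSmoothBdd_ofReal hS.regular hσ).I_mul hS.regular)
      rfl rfl ?_ (by simp) ?_ (by simp)
    · simpa using integral_mul_eq_zero hS hγ hδ (fun e => hinj (by rw [e]))
        (fun e => hinj' (by ext; simp [e]))
    · simpa using ⟨(hρ2.integral_pos hS).ne', (hσ2.integral_pos hS).ne'⟩

lemma expFun_re (k l : ℤ) (x : ℝ × ℝ) : (expFun k l x).re = Real.cos (phase 1 1 k l x) := by
  rw [expFun, mul_comm, Complex.exp_ofReal_mul_I_re, phase, mul_one, mul_one]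

lemma expFun_im (k l : ℤ) (x : ℝ × ℝ) : (expFun k l x).im = Real.sin (phase 1 1 k l x) := by
  rw [expFun, mul_comm, Complex.exp_ofReal_mul_I_im, phase, mul_one, mul_one]

lemma complexSmoothBdd_expFun (hS : IsFourierDomain S 1 1 V) (k l : ℤ) :
    ComplexSmoothBdd S (expFun k l) :=
  ⟨by simpa only [expFun_re] using hS.smoothBdd_cos k l,
    by simpa only [expFun_im] using hS.smoothBdd_sin k l⟩

/-- Here `αβ̄` is an exponential of nonzero frequency: its real part has mean zero and the square of
its imaginary part has mean `1/2`. -/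
theorem sectionalCurvature_expFun (hS : IsFourierDomain S 1 1 V) (hg : IsAssociatedMetric S g)
    (hF : IsOrthonormalFrame S g F) {k l m n : ℤ} (h : (k, l) ≠ (m, n)) :
    HasSectionalCurvature S g (formOf F (expFun k l)) (formOf F (expFun m n))
      (-1 / (4 * V)) := by
  have hV := hS.pos.ne'
  have hne : (k - m, l - n) ≠ ((0, 0) : ℤ × ℤ) := by
    simp only [ne_eq, Prod.mk.injEq] at h ⊢
    omega
  have one : ∀ k l : ℤ, ∫ x in S.dom, ((expFun k l x).re * (expFun k l x).re +
      (expFun k l x).im * (expFun k l x).im) = V := fun k l => by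
    simp only [expFun_re, expFun_im, ← pow_two, Real.cos_sq_add_sin_sq, hS.integral_one]
  refine hasSectionalCurvature_formOf (c := 0) (d := V / 2) hS.regular hg hF
    (complexSmoothBdd_expFun hS k l) (complexSmoothBdd_expFun hS m n) (one k l) (one m n) ?_ ?_
    ?_ ?_
  · simp only [expFun_re, expFun_im, ← Real.cos_sub, ← phase_sub]
    exact hS.integral_cos _ _ hne
  · rw [← hS.integral_half_add (-1) hne]
    refine integral_congr_ae (Filter.Eventually.of_forall fun x => ?_)
    simp only [expFun_re, expFun_im]
    rw [← Real.sin_sub, ← phase_sub, Real.sin_sq, Real.cos_two_mul]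
    ring
  · simpa using hV
  · field_simp
    norm_num

theorem sectionalCurvature_expFun_I_mul (hS : IsFourierDomain S 1 1 V)
    (hg : IsAssociatedMetric S g) (hF : IsOrthonormalFrame S g F) (k l : ℤ)
    (hβ : (β = fun x => Complex.I * expFun k l x) ∨ (β = fun x => -(Complex.I * expFun k l x))) :
    HasSectionalCurvature S g (formOf F (expFun k l)) (formOf F β) (-1 / (2 * V)) := by
  have one : ∀ x, Real.cos (phase 1 1 k l x) * Real.cos (phase 1 1 k l x) +
      Real.sin (phase 1 1 k l x) * Real.sin (phase 1 1 k l x) = 1 := fun x => by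
    rw [← pow_two, ← pow_two, Real.cos_sq_add_sin_sq]
  have htriv : IsTrigSquare 1 1 fun _ => 1 :=
    ⟨0, 0, 1, by norm_num, fun _ => rfl, fun x => by simp [phase_zero]⟩
  have hc := hS.smoothBdd_cos k l
  have hs := hS.smoothBdd_sin k l
  -- The sign `c = ±1` in `β = c i α` treats both alternatives at once.
  obtain ⟨c, hc2, hre, him⟩ : ∃ c : ℝ, c * c = 1 ∧
      (∀ x, (β x).re = -c * Real.sin (phase 1 1 k l x)) ∧
      ∀ x, (β x).im = c * Real.cos (phase 1 1 k l x) := by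
    rcases hβ with rfl | rfl
    · exact ⟨1, by norm_num, by simp [expFun_im], by simp [expFun_re]⟩
    · exact ⟨-1, by norm_num, by simp [expFun_im], by simp [expFun_re]⟩
  have hb : ComplexSmoothBdd S β :=
    ⟨by simpa only [hre] using hs.const_mul hS.regular (-c),
      by simpa only [him] using hc.const_mul hS.regular c⟩
  refine (hasSectionalCurvature_of_orthogonal hS hg hF (complexSmoothBdd_expFun hS k l) hb htriv
    htriv (fun x => ?_) (fun x => ?_) (fun x => ?_) (fun x => ?_)).2.2.2
    (fun _ => rfl) (fun _ => rfl)
  · rw [expFun_re, expFun_im, one]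
  · rw [hre, him]
    linear_combination one x + (Real.cos (phase 1 1 k l x) * Real.cos (phase 1 1 k l x) +
      Real.sin (phase 1 1 k l x) * Real.sin (phase 1 1 k l x)) * hc2
  · rw [expFun_re, expFun_im, hre, him]
    ring
  · rw [expFun_re, expFun_im, hre, him]
    linear_combination (Real.cos (phase 1 1 k l x) * Real.cos (phase 1 1 k l x) +
      Real.sin (phase 1 1 k l x) * Real.sin (phase 1 1 k l x)) ^ 2 * hc2 +
      (Real.cos (phase 1 1 k l x) * Real.cos (phase 1 1 k l x) +
      Real.sin (phase 1 1 k l x) * Real.sin (phase 1 1 k l x) + 1) * one x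

end BasisFunctions

theorem theorem8p4 :
    -- the torus
    (∀ g F : MatField, IsAssociatedMetric torus g → IsOrthonormalFrame torus g F →
      (∀ α β : ℝ × ℝ → ℂ,
        (IsRealBasisFun 1 1 α ∧ IsRealBasisFun 1 1 β) ∨
          (IsImagBasisFun 1 1 α ∧ IsImagBasisFun 1 1 β) →
        LinearIndependent ℝ ![α, β] →
        HasSectionalCurvature torus g (formOf F α) (formOf F β) 0) ∧
      (∀ α β : ℝ × ℝ → ℂ, IsRealBasisFun 1 1 α → IsImagBasisFun 1 1 β → α ≠ 0 → β ≠ 0 →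
        ((¬ (∀ x, ‖α x‖ = ‖β x‖) → ¬ (∀ x, ‖α x‖ ^ 2 + ‖β x‖ ^ 2 = 1) →
          HasSectionalCurvature torus g (formOf F α) (formOf F β) (-1 / (8 * Real.pi ^ 2))) ∧
        ((∀ x, ‖α x‖ ^ 2 + ‖β x‖ ^ 2 = 1) →
          HasSectionalCurvature torus g (formOf F α) (formOf F β) (-1 / (16 * Real.pi ^ 2))) ∧
        ((∀ x, ‖α x‖ = ‖β x‖) → ¬ (∀ x, ‖α x‖ = 1) →
          HasSectionalCurvature torus g (formOf F α) (formOf F β) (-3 / (16 * Real.pi ^ 2))) ∧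
        ((∀ x, ‖α x‖ = 1) → (∀ x, ‖β x‖ = 1) →
          HasSectionalCurvature torus g (formOf F α) (formOf F β) (-1 / (8 * Real.pi ^ 2))))) ∧
      (∀ α : ℝ × ℝ → ℂ, IsRealBasisFun 1 1 α ∨ IsImagBasisFun 1 1 α → α ≠ 0 →
        ((¬ (∀ x, ‖α x‖ = 1) →
          HasSectionalCurvature torus g (formOf F α) (compJ g (formOf F α))
            (-3 / (16 * Real.pi ^ 2))) ∧
        ((∀ x, ‖α x‖ = 1) →
          HasSectionalCurvature torus g (formOf F α) (compJ g (formOf F α))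
            (-1 / (8 * Real.pi ^ 2))))) ∧
      (∀ k l p q : ℤ, (k, l) ≠ (p, q) →
        HasSectionalCurvature torus g (formOf F (expFun k l)) (formOf F (expFun p q))
          (-1 / (16 * Real.pi ^ 2))) ∧
      (∀ (k l : ℤ) (β : ℝ × ℝ → ℂ),
        (β = fun x => Complex.I * expFun k l x) ∨ (β = fun x => -(Complex.I * expFun k l x)) →
        HasSectionalCurvature torus g (formOf F (expFun k l)) (formOf F β)
          (-1 / (8 * Real.pi ^ 2)))) ∧
    -- the sphere, in the coordinates `(φ, z)`
    (∀ g F : MatField, IsAssociatedSphereMetric g → IsOrthonormalFrame sphereChart g F →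
      (∀ α β : ℝ × ℝ → ℂ,
        (IsRealBasisFun 1 Real.pi α ∧ IsRealBasisFun 1 Real.pi β) ∨
          (IsImagBasisFun 1 Real.pi α ∧ IsImagBasisFun 1 Real.pi β) →
        LinearIndependent ℝ ![α, β] →
        HasSectionalCurvature sphereChart g (formOf F α) (formOf F β) 0) ∧
      (∀ α β : ℝ × ℝ → ℂ, IsRealBasisFun 1 Real.pi α → IsImagBasisFun 1 Real.pi β →
        α ≠ 0 → β ≠ 0 →
        ((¬ (∀ x, ‖α x‖ = ‖β x‖) → ¬ (∀ x, ‖α x‖ ^ 2 + ‖β x‖ ^ 2 = 1) →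
          HasSectionalCurvature sphereChart g (formOf F α) (formOf F β) (-1 / (8 * Real.pi))) ∧
        ((∀ x, ‖α x‖ ^ 2 + ‖β x‖ ^ 2 = 1) →
          HasSectionalCurvature sphereChart g (formOf F α) (formOf F β) (-1 / (16 * Real.pi))) ∧
        ((∀ x, ‖α x‖ = ‖β x‖) → ¬ (∀ x, ‖α x‖ = 1) →
          HasSectionalCurvature sphereChart g (formOf F α) (formOf F β) (-3 / (16 * Real.pi))) ∧
        ((∀ x, ‖α x‖ = 1) → (∀ x, ‖β x‖ = 1) →
          HasSectionalCurvature sphereChart g (formOf F α) (formOf F β)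
            (-1 / (8 * Real.pi))))) ∧
      (∀ α : ℝ × ℝ → ℂ, IsRealBasisFun 1 Real.pi α ∨ IsImagBasisFun 1 Real.pi α → α ≠ 0 →
        ((¬ (∀ x, ‖α x‖ = 1) →
          HasSectionalCurvature sphereChart g (formOf F α) (compJ g (formOf F α))
            (-3 / (16 * Real.pi))) ∧
        ((∀ x, ‖α x‖ = 1) →
          HasSectionalCurvature sphereChart g (formOf F α) (compJ g (formOf F α))
            (-1 / (8 * Real.pi)))))) := by
  -- The constants are rewritten in terms of the area `V`, which is `4π²` for the torus and `4π` for
  -- the sphere.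
  have t1 : -1 / (8 * Real.pi ^ 2) = -1 / (2 * (4 * Real.pi ^ 2)) := by ring
  have t2 : -1 / (16 * Real.pi ^ 2) = -1 / (4 * (4 * Real.pi ^ 2)) := by ring
  have t3 : -3 / (16 * Real.pi ^ 2) = -3 / (4 * (4 * Real.pi ^ 2)) := by ring
  have s1 : -1 / (8 * Real.pi) = -1 / (2 * (4 * Real.pi)) := by ring
  have s2 : -1 / (16 * Real.pi) = -1 / (4 * (4 * Real.pi)) := by ring
  have s3 : -3 / (16 * Real.pi) = -3 / (4 * (4 * Real.pi)) := by ring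
  rw [t1, t2, t3, s1, s2, s3]
  have hT := isFourierDomain_torus
  have hS := isFourierDomain_sphereChart
  refine ⟨fun g F hg hF => ⟨fun α β => sectionalCurvature_eq_zero hT hg hF,
    fun α β => sectionalCurvature_real_imag hT hg hF, fun α => sectionalCurvature_compJ hT hg hF,
    fun k l p q => sectionalCurvature_expFun hT hg hF,
    fun k l β => sectionalCurvature_expFun_I_mul hT hg hF k l⟩,
    fun g F hg hF => ⟨fun α β => sectionalCurvature_eq_zero hS hg.1 hF,
    fun α β => sectionalCurvature_real_imag hS hg.1 hF,
    fun α => sectionalCurvature_compJ hS hg.1 hF⟩⟩
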